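/- **Theorem 4.1 (Upper bound on the diameter).** Let $\mathcal L=(\mathcal L_n)_{n\ge1}$ be a sequence of laws on the nonnegative integers. The $\mathcal L$-TBRW (tree builder random walk) started at $(T,x)$, where $T$ is a finite rooted tree with a self-loop attached at its root and $x$ is a vertex of $T$, is the Markov process $(T_n,X_n)_{n\ge 0}$ with $(T_0,X_0)=(T,x)$ in which, at each time $n\ge1$, first a random number $Z_n\sim\mathcal L_n$ of new leaves, independent of everything else, is attached to the vertex $X_{n-1}$ of $T_{n-1}$, which gives $T_n$, and then the walker moves to a uniformly chosen neighbour $X_n$ of $X_{n-1}$ in $T_n$. Here the self-loop makes the root a neighbour of itself, either with multiplicity one or with multiplicity two (loop contributing $2$ to the degree); the statement holds for both conventions. Write $\mathbb P_{T,x;\mathcal L}$ for the law of the process, $|T|$ for the number of vertices of $T$, and $\mathrm{diam}(T_n)$ for the maximal graph distance between two vertices of $T_n$. Let $\mathcal L_n=\mathrm{Ber}(n^{-\gamma})$ for $n\ge 1$, with $\gamma\in(1/2,1)$. Then for all $\varepsilon>0$, $M>0$ and every integer $m\ge1$ there exist constants $C,C'>0$, depending only on $\varepsilon$, $M$, $\gamma$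 and $m$, such that for every finite rooted tree $T$ with $|T|=m$, every vertex $x$ of $T$ and every $n\ge1$, $$\mathbb P_{T,x;\mathcal L}\bigl(\mathrm{diam}(T_n)\ge C n^{\varepsilon}\bigr)\le \frac{C'}{n^{M}}.$$ -/

import Mathlib

open MeasureTheory ProbabilityTheory

/-- A finite rooted tree with vertex set `Fin order`, carrying a walker at the vertex `pos`.
The self-loop at the root is not an edge of the (simple) graph `graph`; it enters through the
walk only, see `TreeWalker.neighbors`. -/
structure TreeWalker where
  order : ℕ
  graph : SimpleGraph (Fin order)
  isTree : graph.IsTree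
  root : Fin order
  pos : Fin order

namespace TreeWalker

/-- The graph obtained from a graph on `Fin k` by adding the vertex `Fin.last k`, joined to the
old vertex `v` only. -/
def leafGraph {k : ℕ} (G : SimpleGraph (Fin k)) (v : Fin k) : SimpleGraph (Fin (k + 1)) :=
  G.map Fin.castSuccEmb ⊔ SimpleGraph.edge v.castSucc (Fin.last k)

theorem leafGraph_isTree {k : ℕ} {G : SimpleGraph (Fin k)} (hG : G.IsTree) (v : Fin k) :
    (leafGraph G v).IsTree := by
  have hne : v.castSucc ≠ Fin.last k := (Fin.castSucc_lt_last v).ne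
  rw [SimpleGraph.isTree_iff_connected_and_card] at hG ⊢
  obtain ⟨hc, hcard⟩ := hG
  constructor
  · have key : ∀ u : Fin (k + 1), (leafGraph G v).Reachable u v.castSucc := by
      intro u
      induction u using Fin.lastCases with
      | last =>
        refine SimpleGraph.Adj.reachable ?_
        simp [leafGraph, SimpleGraph.edge_adj, hne.symm]
      | cast u =>
        have h1 := (hc.preconnected u v).map
          (SimpleGraph.Embedding.map Fin.castSuccEmb G).toHom
        exact h1.mono le_sup_left
    exact ⟨fun a b => (key a).trans (key b).symm⟩
  · have hE : (leafGraph G v).edgeSet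
        = insert s(v.castSucc, Fin.last k) (Fin.castSuccEmb.sym2Map '' G.edgeSet) := by
      rw [leafGraph, SimpleGraph.edgeSet_sup, SimpleGraph.edgeSet_map,
        SimpleGraph.edgeSet_edge, Set.union_comm, Set.insert_eq]
      congr 1
      ext e
      simp only [Set.mem_sdiff, Set.mem_singleton_iff, and_iff_left_iff_imp]
      rintro rfl
      simp
    have hnot : s(v.castSucc, Fin.last k) ∉ Fin.castSuccEmb.sym2Map '' G.edgeSet := by
      rintro ⟨e, -, he⟩
      induction e with
      | _ a b =>
        simp only [Function.Embedding.sym2Map_apply, Sym2.map_mk, Sym2.eq_iff,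
          Fin.coe_castSuccEmb] at he
        rcases he with ⟨-, h⟩ | ⟨h, -⟩
        · exact (Fin.castSucc_lt_last b).ne h
        · exact (Fin.castSucc_lt_last a).ne h
    rw [hE, Nat.card_coe_set_eq, Set.ncard_insert_of_notMem hnot (Set.toFinite _),
      Set.ncard_image_of_injective _ Fin.castSuccEmb.sym2Map.injective,
      ← Nat.card_coe_set_eq, hcard]
    simp

/-- Attach one new leaf to the vertex at which the walker stands; the walker does not move. -/
def addLeaf (s : TreeWalker) : TreeWalker where
  order := s.order + 1
  graph := leafGraph s.graph s.pos
  isTree := leafGraph_isTree s.isTree s.pos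
  root := s.root.castSucc
  pos := s.pos.castSucc

/-- Attach `z` new leaves to the vertex at which the walker stands. -/
def addLeaves (z : ℕ) (s : TreeWalker) : TreeWalker := addLeaf^[z] s

open scoped Classical in
/-- The neighbours of the walker's position, the self-loop at the root making the root a neighbour
of itself with multiplicity `ℓ`. For `ℓ = 1` every neighbour is listed once; for `ℓ = 2` the loop
contributes `2` to the degree of the root. -/
noncomputable def neighbors (ℓ : ℕ+) (s : TreeWalker) : Multiset (Fin s.order) :=
  (s.graph.neighborFinset s.pos).val +
    (if s.pos = s.root then Multiset.replicate ℓ s.root else 0)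

theorem neighbors_ne_zero (ℓ : ℕ+) (s : TreeWalker) : s.neighbors ℓ ≠ 0 := by
  classical
  intro h
  rw [neighbors, add_eq_zero] at h
  obtain ⟨h1, h2⟩ := h
  by_cases hp : s.pos = s.root
  · rw [if_pos hp] at h2
    have := congrArg Multiset.card h2
    simp at this
  · have : Nontrivial (Fin s.order) := ⟨s.pos, s.root, hp⟩
    have hd := s.isTree.connected.preconnected.degree_pos_of_nontrivial s.pos
    rw [← SimpleGraph.card_neighborFinset_eq_degree, Finset.card_pos] at hd
    obtain ⟨x, hx⟩ := hd
    rw [← Finset.mem_val] at hx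
    have h3 : x ∈ (0 : Multiset (Fin s.order)) := by
      rw [← h1]; convert hx
    simp at h3

/-- The walker moves to a uniformly chosen neighbour; the tree does not change. -/
noncomputable def walk (ℓ : ℕ+) (s : TreeWalker) : PMF TreeWalker :=
  (PMF.ofMultiset (s.neighbors ℓ) (s.neighbors_ne_zero ℓ)).map fun u => { s with pos := u }

/-- One time step: a number of leaves with law `L` is added at the walker's position, and then the
walker steps on the resulting tree. -/
noncomputable def step (ℓ : ℕ+) (L : PMF ℕ) (s : TreeWalker) : PMF TreeWalker :=
  L.bind fun z => (s.addLeaves z).walk ℓ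

instance : MeasurableSpace TreeWalker := ⊤

/-- `step` as a Markov kernel. -/
noncomputable def stepKernel (ℓ : ℕ+) (L : PMF ℕ) : Kernel TreeWalker TreeWalker where
  toFun s := (s.step ℓ L).toMeasure
  measurable' := measurable_from_top

instance (ℓ : ℕ+) (L : PMF ℕ) : IsMarkovKernel (stepKernel ℓ L) :=
  ⟨fun s => inferInstanceAs (IsProbabilityMeasure (s.step ℓ L).toMeasure)⟩

end TreeWalker

/-- The law of the process `(T n, X n)`, `n ≥ 0`, of the tree builder random walk started at `s₀`,
as a measure on trajectories; the number of leaves added at time `n ≥ 1` has law `L n`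
(so `L 0` is not used). -/
noncomputable def tbrwLaw (ℓ : ℕ+) (L : ℕ → PMF ℕ) (s₀ : TreeWalker) :
    Measure (ℕ → TreeWalker) :=
  Kernel.traj (X := fun _ : ℕ => TreeWalker)
    (fun n => (TreeWalker.stepKernel ℓ (L (n + 1))).comap
      (fun x : (i : Finset.Iic n) → TreeWalker => x ⟨n, Finset.mem_Iic.2 le_rfl⟩)
      (measurable_pi_apply _)) 0 (fun _ => s₀)

instance (ℓ : ℕ+) (L : ℕ → PMF ℕ) (s₀ : TreeWalker) : IsProbabilityMeasure (tbrwLaw ℓ L s₀) := by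
  unfold tbrwLaw; infer_instance

theorem natCast_rpow_neg_mem_unitInterval {γ : ℝ} (hγ : 0 ≤ γ) (n : ℕ) :
    (n : ℝ) ^ (-γ) ∈ unitInterval := by
  refine ⟨Real.rpow_nonneg n.cast_nonneg _, ?_⟩
  rcases Nat.eq_zero_or_pos n with rfl | hn
  · rcases hγ.eq_or_lt with rfl | h
    · simp
    · simp [Real.zero_rpow (neg_ne_zero.2 h.ne')]
  · exact Real.rpow_le_one_of_one_le_of_nonpos (by exact_mod_cast hn) (by linarith)

/-- The Bernoulli laws on `{0, 1} ⊆ ℕ` with success probabilities `n ^ (-γ)`. -/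
noncomputable def berLaws (γ : ℝ) (hγ : 0 ≤ γ) (n : ℕ) : PMF ℕ :=
  (bernoulliMeasure (1 : ℕ) 0
    ⟨(n : ℝ) ^ (-γ), natCast_rpow_neg_mem_unitInterval hγ n⟩).toPMF

/-! Give each vertex the weight `2 ^ depth` and let the energy be the degree-weighted sum of these
weights. Some vertex has depth at least half the diameter, so a large diameter forces an
exponentially large energy. A new leaf at the walker adds exactly three times the weight of the
walker's position. If the walker were at stationarity on the current tree, a step with leaf
probability `p` would thus multiply the energy on average by `1 + 3 p / volume`, which is harmless.

The walker is not stationary, so the local weight is replaced by its mean through a Poisson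
equation. On a tree its solution is explicit: exactly one neighbour of `x ≠ v` is closer to `v`, so
the graph Laplacian of the distance to `v` is a constant depending on `x` plus a point mass at `v`
(`IsTree.sum_dist_neighborFinset`), and the constant is lost against a centred charge. Hence
`corrector`, which is at most diameter times energy. Adding a multiple `a` of it, with `a` of the
order of `p`, gives a Lyapunov function with growth rate of order `p / volume + p ^ 2 * D` per step
while the diameter stays below `D` (`stepExp_lyapunov_le`).

This yields a bootstrap. Suppose the diameter is `O(n ^ e)` at time `n`. Start from time `t ≈ n ^ (1
- η)`, where the same hypothesis gives diameter `O(n ^ ((1 - η) * e))` and the volume is at least of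
order `t ^ (1 - γ)`. Up to time `n` the logarithm of the Lyapunov function grows by at most a
constant times `n / t + n * t ^ (-2 * γ) * n ^ e`. Because `γ > 1/2`, this is `O(n ^ ((1 - η) * e))`
for small `η`, so Markov's inequality improves the exponent from `e` to `(1 - η) * e`
(`HasDiamTail.improve`). The number of vertices gives the initial exponent `1 / 2`, and finitely
many improvements reach any `ε > 0`. -/

namespace SimpleGraph

/-! ### Distances to a fixed vertex of a tree -/

theorem IsTree.exists_adj_dist_eq {V : Type*} {G : SimpleGraph V} (hG : G.IsTree) {x v : V}
    (hxv : x ≠ v) :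
    ∃ z, G.Adj x z ∧ G.dist z v + 1 = G.dist x v ∧
      ∀ y, G.Adj x y → y ≠ z → G.dist y v = G.dist x v + 1 := by
  obtain ⟨p, hp, hlen⟩ := (hG.connected x v).exists_path_of_dist
  cases p with
  | nil => exact absurd rfl hxv
  | @cons _ z _ hz q =>
    have hq : G.dist z v ≤ q.length := dist_le q
    have h1 : G.dist x v ≤ G.dist z v + 1 := by
      obtain ⟨r, hr⟩ := (hG.connected z v).exists_walk_length_eq_dist
      have := dist_le (Walk.cons hz r)
      simpa [hr] using this
    have hzd : G.dist z v + 1 = G.dist x v := by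
      simp only [Walk.length_cons] at hlen
      omega
    refine ⟨z, hz, hzd, fun y hy hyz => ?_⟩
    have hd := hG.dist_eq_dist_add_one_of_adj v hy
    rw [dist_comm (v := x), dist_comm (v := y)] at hd
    rcases hd with hd | hd
    · exfalso
      obtain ⟨r, hr⟩ := (hG.connected y v).exists_walk_length_eq_dist
      have hpath : (Walk.cons hy r).IsPath := by
        apply Walk.isPath_of_length_eq_dist
        simp [hr, hd]
      have := congrArg Subtype.val
        ((hG.isAcyclic.subsingleton_path x v).elim ⟨Walk.cons hy r, hpath⟩ ⟨Walk.cons hz q, hp⟩)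
      simp only [Walk.cons.injEq] at this
      exact hyz this.1
    · exact hd

/-- All neighbours of `x ≠ v` are one step farther from `v`, except the one on the path to `v`,
which is one step closer; at `x = v` the exception is absent. The part not involving `v` will cancel
in `walkExp_corrector`. -/
theorem IsTree.sum_dist_neighborFinset {V : Type*} {G : SimpleGraph V} (hG : G.IsTree) (x v : V)
    [Fintype (G.neighborSet x)] [DecidableEq V] :
    ∑ y ∈ G.neighborFinset x, ((G.dist y v : ℝ) - G.dist x v)
      = G.degree x - 2 + if x = v then 2 else 0 := by
  by_cases hxv : x = v
  · subst hxv
    rw [if_pos rfl, Finset.sum_congr rfl (g := fun _ => (1 : ℝ))]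
    · simp
    · intro y hy
      rw [mem_neighborFinset] at hy
      simp [dist_eq_one_iff_adj.2 hy.symm]
  · obtain ⟨z, hz, hzd, hy⟩ := hG.exists_adj_dist_eq hxv
    rw [if_neg hxv, Finset.sum_congr rfl (g := fun y => 1 + if y = z then (-2 : ℝ) else 0)]
    · rw [Finset.sum_add_distrib, Finset.sum_ite_eq', if_pos ((G.mem_neighborFinset x z).2 hz)]
      simp
      ring
    · intro y hxy
      rw [mem_neighborFinset] at hxy
      split_ifs with h
      · subst h
        rw [← hzd]; push_cast; ring
      · rw [hy y hxy h]; push_cast; ring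

theorem Connected.dist_le_diam_of_finite {V : Type*} [Finite V] {G : SimpleGraph V}
    (hG : G.Connected) (u v : V) : G.dist u v ≤ G.diam := by
  have := hG.nonempty
  exact dist_le_diam (connected_iff_ediam_ne_top.1 hG)

end SimpleGraph

/-! ### Effect of a new leaf on distances, degrees and diameter -/

namespace TreeWalker
open SimpleGraph

section leafGraph

variable {k : ℕ} {G : SimpleGraph (Fin k)} (v : Fin k)

theorem leafGraph_adj_castSucc {a b : Fin k} :
    (leafGraph G v).Adj a.castSucc b.castSucc ↔ G.Adj a b := by
  have hb := (Fin.castSucc_lt_last b).ne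
  have ha := (Fin.castSucc_lt_last a).ne
  rw [leafGraph, sup_adj, map_adj, edge_adj]
  simp [ha, hb]

theorem leafGraph_adj_last {a : Fin k} :
    (leafGraph G v).Adj a.castSucc (Fin.last k) ↔ a = v := by
  have ha := (Fin.castSucc_lt_last a).ne
  rw [leafGraph, sup_adj, map_adj, edge_adj]
  simp [ha]

/-- A shortest path of the old tree is still a path in the new one, and paths in a tree are unique.
-/
theorem leafGraph_dist_castSucc (hG : G.IsTree) (a b : Fin k) :
    (leafGraph G v).dist a.castSucc b.castSucc = G.dist a b := by
  obtain ⟨p, hp, hlen⟩ := (hG.connected a b).exists_path_of_dist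
  let f : G →g leafGraph G v := ⟨Fin.castSucc, (leafGraph_adj_castSucc v).2⟩
  have hf : Function.Injective f := Fin.castSucc_injective k
  have hT := leafGraph_isTree hG v
  obtain ⟨q, hq, hql⟩ := (hT.connected a.castSucc b.castSucc).exists_path_of_dist
  have := congrArg Subtype.val
    ((hT.isAcyclic.subsingleton_path _ _).elim ⟨q, hq⟩ ⟨p.map f, hp.map hf⟩)
  simp only at this
  rw [← hql, this, Walk.length_map, hlen]

theorem leafGraph_dist_last (hG : G.IsTree) (a : Fin k) :
    (leafGraph G v).dist a.castSucc (Fin.last k) = G.dist a v + 1 := by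
  have hT := leafGraph_isTree hG v
  have hadj : (leafGraph G v).Adj (Fin.last k) v.castSucc := ((leafGraph_adj_last v).2 rfl).symm
  obtain ⟨z, hz, hzd, -⟩ := hT.exists_adj_dist_eq (Fin.castSucc_lt_last a).ne'
  obtain ⟨z, rfl⟩ | rfl := z.eq_castSucc_or_eq_last
  · obtain rfl := (leafGraph_adj_last v).1 hz.symm
    rw [dist_comm, ← hzd, leafGraph_dist_castSucc _ hG, dist_comm]
  · exact absurd hz (SimpleGraph.irrefl _)

open scoped Classical in
theorem leafGraph_degree_castSucc (a : Fin k) :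
    (leafGraph G v).degree a.castSucc = G.degree a + if a = v then 1 else 0 := by
  rw [← card_neighborFinset_eq_degree, ← card_neighborFinset_eq_degree]
  have : (leafGraph G v).neighborFinset a.castSucc
      = (G.neighborFinset a).map Fin.castSuccEmb ∪ if a = v then {Fin.last k} else ∅ := by
    ext b
    obtain ⟨b, rfl⟩ | rfl := b.eq_castSucc_or_eq_last
    · have hb := (Fin.castSucc_lt_last b).ne
      by_cases h : a = v <;> simp [leafGraph_adj_castSucc, hb, h]
    · by_cases h : a = v <;> simp [leafGraph_adj_last, h]
  rw [this]
  split_ifs with h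
  · rw [Finset.card_union_of_disjoint, Finset.card_map, Finset.card_singleton]
    simp
  · simp

open scoped Classical in
theorem leafGraph_degree_last : (leafGraph G v).degree (Fin.last k) = 1 := by
  rw [← card_neighborFinset_eq_degree, Finset.card_eq_one]
  refine ⟨v.castSucc, ?_⟩
  ext b
  rw [mem_neighborFinset, Finset.mem_singleton]
  obtain ⟨b, rfl⟩ | rfl := b.eq_castSucc_or_eq_last
  · rw [adj_comm, leafGraph_adj_last]; simp
  · simpa using (Fin.castSucc_lt_last v).ne'

theorem leafGraph_diam_ge (hG : G.IsTree) : G.diam ≤ (leafGraph G v).diam := by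
  have := hG.connected.nonempty
  obtain ⟨a, b, hab⟩ := G.exists_dist_eq_diam
  rw [← hab, ← leafGraph_dist_castSucc v hG]
  exact (leafGraph_isTree hG v).connected.dist_le_diam_of_finite _ _

theorem leafGraph_diam_le (hG : G.IsTree) : (leafGraph G v).diam ≤ G.diam + 1 := by
  have h := hG.connected.dist_le_diam_of_finite
  obtain ⟨a, b, hab⟩ := (leafGraph G v).exists_dist_eq_diam
  rw [← hab]
  obtain ⟨a, rfl⟩ | rfl := a.eq_castSucc_or_eq_last <;>
    obtain ⟨b, rfl⟩ | rfl := b.eq_castSucc_or_eq_last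
  · rw [leafGraph_dist_castSucc v hG]; exact (h _ _).trans (Nat.le_succ _)
  · rw [leafGraph_dist_last v hG]; exact Nat.succ_le_succ (h _ _)
  · rw [dist_comm, leafGraph_dist_last v hG]; exact Nat.succ_le_succ (h _ _)
  · simp

end leafGraph

end TreeWalker

/-! ### Expectations under discrete laws -/

theorem PMF.lintegral_toMeasure {α : Type*} [MeasurableSpace α] [MeasurableSingletonClass α]
    (p : PMF α) {F : α → ENNReal} (hF : Measurable F) :
    ∫⁻ x, F x ∂p.toMeasure = ∑' x, p x * F x := by
  have h : p.toMeasure = Measure.sum fun x => p x • Measure.dirac x := by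
    ext s hs
    rw [p.toMeasure_apply_eq_tsum, Measure.sum_apply _ hs]
    refine tsum_congr fun x => ?_
    by_cases hx : x ∈ s <;> simp [hs, hx]
  rw [h, lintegral_sum_measure]
  refine tsum_congr fun x => ?_
  rw [lintegral_smul_measure, lintegral_dirac' _ hF, smul_eq_mul]

theorem PMF.tsum_bind_mul {α β : Type*} (p : PMF α) (f : α → PMF β) (F : β → ENNReal) :
    ∑' b, p.bind f b * F b = ∑' a, p a * ∑' b, f a b * F b := by
  simp_rw [PMF.bind_apply, ← ENNReal.tsum_mul_right, ← ENNReal.tsum_mul_left, mul_assoc]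
  exact ENNReal.tsum_comm

theorem PMF.tsum_map_mul {α β : Type*} (p : PMF α) (f : α → β) (F : β → ENNReal) :
    ∑' b, p.map f b * F b = ∑' a, p a * F (f a) := by
  rw [PMF.map, PMF.tsum_bind_mul]
  refine tsum_congr fun a => ?_
  rw [tsum_eq_single (f a)]
  · simp
  · intro b hb
    simp [hb]

theorem PMF.tsum_ofMultiset_mul {α : Type*} (S : Multiset α) (hS : S ≠ 0) {F : α → ℝ}
    (hF : 0 ≤ F) :
    ∑' a, PMF.ofMultiset S hS a * ENNReal.ofReal (F a)
      = ENNReal.ofReal ((S.map F).sum / Multiset.card S) := by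
  classical
  have hc : (0 : ℝ) < Multiset.card S := by exact_mod_cast Multiset.card_pos.2 hS
  rw [tsum_eq_sum (s := S.toFinset), Finset.sum_multiset_map_count, Finset.sum_div,
    ENNReal.ofReal_sum_of_nonneg]
  · refine Finset.sum_congr rfl fun a _ => ?_
    rw [PMF.ofMultiset_apply, nsmul_eq_mul, mul_div_right_comm, ENNReal.ofReal_mul (by positivity),
      ENNReal.ofReal_div_of_pos hc, ENNReal.ofReal_natCast, ENNReal.ofReal_natCast]
  · intro a _
    have := hF a
    simp only [Pi.zero_apply] at this
    positivity
  · intro a ha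
    rw [PMF.ofMultiset_apply_of_notMem hS (by simpa using ha), zero_mul]

/-! ### From the trajectory law to iterated one-step expectations -/

namespace TreeWalker

/-- The expectation of `F` after the walker moved to a uniformly chosen neighbour. -/
noncomputable def walkExp (ℓ : ℕ+) (F : TreeWalker → ℝ) (s : TreeWalker) : ℝ :=
  ((s.neighbors ℓ).map fun u => F { s with pos := u }).sum / Multiset.card (s.neighbors ℓ)

/-- The expectation of `F` after one time step in which a leaf is added with probability `p`. -/
noncomputable def stepExp (ℓ : ℕ+) (p : ℝ) (F : TreeWalker → ℝ) (s : TreeWalker) : ℝ :=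
  (1 - p) * walkExp ℓ F s + p * walkExp ℓ F s.addLeaf

/-- The expectation of `F` at time `t + k` for the process started at time `t`, leaves being added
at time `i` with probability `p i`. -/
noncomputable def evolve (ℓ : ℕ+) (p : ℕ → ℝ) (t : ℕ) :
    ℕ → (TreeWalker → ℝ) → TreeWalker → ℝ
  | 0, F => F
  | k + 1, F => evolve ℓ p t k (stepExp ℓ (p (t + k + 1)) F)

theorem walkExp_mono {ℓ : ℕ+} {F G : TreeWalker → ℝ} {s : TreeWalker}
    (h : ∀ u, F { s with pos := u } ≤ G { s with pos := u }) :
    walkExp ℓ F s ≤ walkExp ℓ G s := by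
  unfold walkExp
  gcongr
  exact Multiset.sum_map_le_sum_map _ _ fun u _ => h u

theorem walkExp_const_of_forall {ℓ : ℕ+} {F : TreeWalker → ℝ} {s : TreeWalker} {c : ℝ}
    (h : ∀ u, F { s with pos := u } = c) : walkExp ℓ F s = c := by
  have hc : (Multiset.card (s.neighbors ℓ) : ℝ) ≠ 0 := by
    simpa using s.neighbors_ne_zero ℓ
  unfold walkExp
  simp_rw [h]
  rw [Multiset.map_const', Multiset.sum_replicate, nsmul_eq_mul, mul_div_cancel_left₀ _ hc]

theorem walkExp_nonneg {ℓ : ℕ+} {F : TreeWalker → ℝ} (hF : 0 ≤ F) (s : TreeWalker) :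
    0 ≤ walkExp ℓ F s :=
  (walkExp_const_of_forall (ℓ := ℓ) (F := 0) (s := s) fun _ => rfl).ge.trans
    (walkExp_mono fun _ => hF _)

theorem stepExp_nonneg {ℓ : ℕ+} {p : ℝ} (h0 : 0 ≤ p) (h1 : p ≤ 1) {F : TreeWalker → ℝ}
    (hF : 0 ≤ F) : 0 ≤ stepExp ℓ p F := by
  intro s
  have h2 : 0 ≤ 1 - p := by linarith
  exact add_nonneg (mul_nonneg h2 (walkExp_nonneg hF _)) (mul_nonneg h0 (walkExp_nonneg hF _))

theorem tsum_walk_mul (ℓ : ℕ+) {F : TreeWalker → ℝ} (hF : 0 ≤ F) (s : TreeWalker) :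
    ∑' x, s.walk ℓ x * ENNReal.ofReal (F x) = ENNReal.ofReal (walkExp ℓ F s) := by
  rw [walk, PMF.tsum_map_mul]
  exact PMF.tsum_ofMultiset_mul _ _ fun u => hF _

theorem tsum_step_berLaws_mul {γ : ℝ} (hγ : 0 ≤ γ) (n : ℕ) (ℓ : ℕ+) {F : TreeWalker → ℝ}
    (hF : 0 ≤ F) (s : TreeWalker) :
    ∑' x, s.step ℓ (berLaws γ hγ n) x * ENNReal.ofReal (F x)
      = ENNReal.ofReal (stepExp ℓ ((n : ℝ) ^ (-γ)) F s) := by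
  obtain ⟨h0, h1⟩ := natCast_rpow_neg_mem_unitInterval hγ n
  have h2 : 0 ≤ 1 - (n : ℝ) ^ (-γ) := by linarith
  rw [step, PMF.tsum_bind_mul]
  simp_rw [tsum_walk_mul ℓ hF]
  rw [← PMF.lintegral_toMeasure _ (measurable_of_countable _), berLaws, Measure.toPMF_toMeasure,
    bernoulliMeasure_def, lintegral_add_measure, lintegral_smul_measure, lintegral_smul_measure,
    lintegral_dirac, lintegral_dirac, stepExp, add_comm,
    ENNReal.ofReal_add (mul_nonneg h2 (walkExp_nonneg hF _)) (mul_nonneg h0 (walkExp_nonneg hF _)),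
    ENNReal.ofReal_mul h2, ENNReal.ofReal_mul h0]
  congr 1
  · rw [ENNReal.smul_def, smul_eq_mul]
    congr 1
    rw [ENNReal.ofReal, ENNReal.coe_inj]
    ext
    simp [h1]
  · rw [ENNReal.smul_def, smul_eq_mul]
    congr 1
    rw [ENNReal.ofReal, ENNReal.coe_inj]
    ext
    simp [h0]

/-- The Markov property: the trajectory is split at time `n` into a partial trajectory and its
continuation, whose next coordinate has the step kernel as its law. -/
theorem lintegral_tbrwLaw_succ (ℓ : ℕ+) (L : ℕ → PMF ℕ) (s₀ : TreeWalker) (n : ℕ)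
    (F : TreeWalker → ENNReal) :
    ∫⁻ ω, F (ω (n + 1)) ∂tbrwLaw ℓ L s₀
      = ∫⁻ ω, ∫⁻ x, F x ∂stepKernel ℓ (L (n + 1)) (ω n) ∂tbrwLaw ℓ L s₀ := by
  let κ : (n : ℕ) → Kernel ((i : Finset.Iic n) → TreeWalker) TreeWalker := fun n =>
    (stepKernel ℓ (L (n + 1))).comap
      (fun x : (i : Finset.Iic n) → TreeWalker => x ⟨n, Finset.mem_Iic.2 le_rfl⟩)
      (measurable_pi_apply _)
  have hF : Measurable F := measurable_from_top
  have hlaw : tbrwLaw ℓ L s₀ = (Kernel.traj (X := fun _ : ℕ => TreeWalker) κ n ∘ₖ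
      Kernel.partialTraj (X := fun _ : ℕ => TreeWalker) κ 0 n) fun _ => s₀ := by
    rw [Kernel.traj_comp_partialTraj (X := fun _ : ℕ => TreeWalker) (Nat.zero_le n)]
    rfl
  rw [hlaw]
  have e1 := fun (G : TreeWalker → ENNReal) (k : ℕ) => Kernel.lintegral_comp
    (Kernel.traj (X := fun _ : ℕ => TreeWalker) κ n)
    (Kernel.partialTraj (X := fun _ : ℕ => TreeWalker) κ 0 n) (fun _ => s₀)
    (g := fun ω => G (ω k)) ((measurable_from_top (f := G)).comp (measurable_pi_apply k))
  rw [e1 F (n + 1), e1 (fun s => ∫⁻ x, F x ∂stepKernel ℓ (L (n + 1)) s) n]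
  refine lintegral_congr fun x => ?_
  rw [← Kernel.lintegral_map _ (by fun_prop) _ hF, Kernel.map_traj_succ_self]
  have e2 : ∫⁻ ω, (fun y : (i : Finset.Iic n) → TreeWalker =>
        ∫⁻ x, F x ∂stepKernel ℓ (L (n + 1)) (y ⟨n, Finset.mem_Iic.2 le_rfl⟩))
          (Preorder.frestrictLe (π := fun _ : ℕ => TreeWalker) n ω)
        ∂Kernel.traj (X := fun _ : ℕ => TreeWalker) κ n x
      = ∫⁻ x_1, F x_1 ∂(κ n) x := by
    have hm : Measurable (fun y : (i : Finset.Iic n) → TreeWalker =>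
        ∫⁻ x, F x ∂stepKernel ℓ (L (n + 1)) (y ⟨n, Finset.mem_Iic.2 le_rfl⟩)) :=
      (measurable_from_top (f := fun s => ∫⁻ x, F x ∂stepKernel ℓ (L (n + 1)) s)).comp
        (measurable_pi_apply _)
    rw [← Kernel.lintegral_map _ (by fun_prop) _ hm, Kernel.traj_map_frestrictLe,
      Kernel.partialTraj_self, Kernel.id_apply, lintegral_dirac' _ hm]
    rfl
  exact e2.symm

theorem lintegral_tbrwLaw_zero (ℓ : ℕ+) (L : ℕ → PMF ℕ) (s₀ : TreeWalker)
    (F : TreeWalker → ENNReal) : ∫⁻ ω, F (ω 0) ∂tbrwLaw ℓ L s₀ = F s₀ := by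
  have hm : Measurable (fun y : (i : Finset.Iic 0) → TreeWalker =>
      F (y ⟨0, Finset.mem_Iic.2 le_rfl⟩)) :=
    (measurable_from_top (f := F)).comp (measurable_pi_apply _)
  change ∫⁻ ω, (fun y : (i : Finset.Iic 0) → TreeWalker =>
      F (y ⟨0, Finset.mem_Iic.2 le_rfl⟩))
        (Preorder.frestrictLe (π := fun _ : ℕ => TreeWalker) 0 ω) ∂tbrwLaw ℓ L s₀ = _
  rw [tbrwLaw, ← Kernel.lintegral_map _ (by fun_prop) _ hm, Kernel.traj_map_frestrictLe,
    Kernel.partialTraj_self, Kernel.id_apply, lintegral_dirac' _ hm]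

theorem lintegral_tbrwLaw_berLaws {γ : ℝ} (hγ : 0 ≤ γ) (ℓ : ℕ+) (s₀ : TreeWalker) (n : ℕ)
    {F : TreeWalker → ℝ} (hF : 0 ≤ F) :
    ∫⁻ ω, ENNReal.ofReal (F (ω n)) ∂tbrwLaw ℓ (berLaws γ hγ) s₀
      = ENNReal.ofReal (evolve ℓ (fun i => (i : ℝ) ^ (-γ)) 0 n F s₀) := by
  induction n generalizing F with
  | zero => exact lintegral_tbrwLaw_zero _ _ _ fun s => ENNReal.ofReal (F s)
  | succ n ih =>
    obtain ⟨h0, h1⟩ := natCast_rpow_neg_mem_unitInterval hγ (n + 1)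
    rw [lintegral_tbrwLaw_succ _ _ _ _ fun s => ENNReal.ofReal (F s), evolve, zero_add,
      ← ih (stepExp_nonneg h0 h1 hF)]
    refine lintegral_congr fun ω => ?_
    rw [← tsum_step_berLaws_mul hγ _ _ hF]
    exact PMF.lintegral_toMeasure _ measurable_from_top

/-- Reduces the theorem to estimates on `evolve`, with no further measure theory. The maximum with
`0` comes from `ENNReal.ofReal` and spares a separate proof of nonnegativity. -/
theorem tbrwLaw_berLaws_real_setOf {γ : ℝ} (hγ : 0 ≤ γ) (ℓ : ℕ+) (s₀ : TreeWalker) (n : ℕ)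
    (A : Set TreeWalker) :
    (tbrwLaw ℓ (berLaws γ hγ) s₀).real {ω | ω n ∈ A}
      = max (evolve ℓ (fun i => (i : ℝ) ^ (-γ)) 0 n (A.indicator 1) s₀) 0 := by
  have hA : MeasurableSet {ω : ℕ → TreeWalker | ω n ∈ A} :=
    measurable_pi_apply n (MeasurableSpace.measurableSet_top (s := A))
  have h1 : 0 ≤ A.indicator (1 : TreeWalker → ℝ) :=
    fun s => Set.indicator_nonneg (fun _ _ => zero_le_one) s
  rw [measureReal_def, ← ENNReal.toReal_ofReal', ← lintegral_tbrwLaw_berLaws hγ ℓ s₀ n h1,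
    ← lintegral_indicator_one hA]
  congr 1
  refine lintegral_congr fun ω => ?_
  by_cases h : ω n ∈ A <;> simp [h]

/-- Trees never shrink, so a comparison valid above size `V` survives a step. A volume bound at the
start of a time window can therefore be used throughout it. -/
theorem stepExp_mono_of_le_order {ℓ : ℕ+} {p V : ℝ} (h0 : 0 ≤ p) (h1 : p ≤ 1)
    {F G : TreeWalker → ℝ} (h : ∀ s : TreeWalker, V ≤ s.order → F s ≤ G s) (s : TreeWalker)
    (hs : V ≤ s.order) : stepExp ℓ p F s ≤ stepExp ℓ p G s := by
  have hs' : V ≤ s.addLeaf.order := hs.trans (by exact_mod_cast Nat.le_succ s.order)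
  exact add_le_add
    (mul_le_mul_of_nonneg_left (walkExp_mono fun u => h { s with pos := u } hs)
      (sub_nonneg.2 h1))
    (mul_le_mul_of_nonneg_left (walkExp_mono fun u => h { s.addLeaf with pos := u } hs') h0)

theorem walkExp_add (ℓ : ℕ+) (F G : TreeWalker → ℝ) (s : TreeWalker) :
    walkExp ℓ (F + G) s = walkExp ℓ F s + walkExp ℓ G s := by
  simp [walkExp, Multiset.sum_map_add, add_div]

theorem walkExp_smul (ℓ : ℕ+) (c : ℝ) (F : TreeWalker → ℝ) (s : TreeWalker) :
    walkExp ℓ (c • F) s = c * walkExp ℓ F s := by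
  simp [walkExp, Multiset.sum_map_mul_left, mul_div_assoc]

theorem stepExp_add (ℓ : ℕ+) (p : ℝ) (F G : TreeWalker → ℝ) :
    stepExp ℓ p (F + G) = stepExp ℓ p F + stepExp ℓ p G := by
  ext s
  simp only [stepExp, walkExp_add, Pi.add_apply]
  ring

theorem stepExp_smul (ℓ : ℕ+) (p c : ℝ) (F : TreeWalker → ℝ) :
    stepExp ℓ p (c • F) = c • stepExp ℓ p F := by
  ext s
  simp only [stepExp, walkExp_smul, Pi.smul_apply, smul_eq_mul]
  ring

section evolve

variable {ℓ : ℕ+} {p : ℕ → ℝ}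

theorem evolve_add_time (t j k : ℕ) (F : TreeWalker → ℝ) :
    evolve ℓ p t (j + k) F = evolve ℓ p t j (evolve ℓ p (t + j) k F) := by
  induction k generalizing F with
  | zero => rfl
  | succ k ih => rw [← add_assoc, evolve, ih, evolve, add_assoc t j k]

theorem evolve_mono_of_le_order (hp : ∀ i, p i ∈ unitInterval) (t k : ℕ) {V : ℝ}
    {F G : TreeWalker → ℝ} (h : ∀ s : TreeWalker, V ≤ s.order → F s ≤ G s) (s : TreeWalker)
    (hs : V ≤ s.order) : evolve ℓ p t k F s ≤ evolve ℓ p t k G s := by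
  induction k generalizing F G with
  | zero => exact h s hs
  | succ k ih => exact ih (stepExp_mono_of_le_order (hp _).1 (hp _).2 h)

theorem evolve_mono (hp : ∀ i, p i ∈ unitInterval) (t k : ℕ) {F G : TreeWalker → ℝ}
    (h : F ≤ G) : evolve ℓ p t k F ≤ evolve ℓ p t k G := fun s =>
  evolve_mono_of_le_order hp t k (fun s _ => h s) s le_rfl

theorem evolve_add (t k : ℕ) (F G : TreeWalker → ℝ) :
    evolve ℓ p t k (F + G) = evolve ℓ p t k F + evolve ℓ p t k G := by
  induction k generalizing F G with
  | zero => rfl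
  | succ k ih => rw [evolve, stepExp_add, ih]; rfl

theorem evolve_smul (t k : ℕ) (c : ℝ) (F : TreeWalker → ℝ) :
    evolve ℓ p t k (c • F) = c • evolve ℓ p t k F := by
  induction k generalizing F with
  | zero => rfl
  | succ k ih => rw [evolve, stepExp_smul, ih]; rfl

end evolve

end TreeWalker

/-! ### Energy, corrector and the Lyapunov function -/

namespace TreeWalker
open SimpleGraph

open scoped Classical in
/-- The degree of a vertex, the self-loop at the root counting `ℓ` times. -/
noncomputable def loopDegree (ℓ : ℕ+) (s : TreeWalker) (v : Fin s.order) : ℝ :=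
  s.graph.degree v + if v = s.root then ((ℓ : ℕ) : ℝ) else 0

/-- The exponential weight `2 ^ depth` of a vertex. -/
noncomputable def weight (s : TreeWalker) (v : Fin s.order) : ℝ :=
  2 ^ s.graph.dist s.root v

noncomputable def volume (ℓ : ℕ+) (s : TreeWalker) : ℝ := ∑ v, s.loopDegree ℓ v

/-- Degrees are proportional to the stationary law of the walk on the frozen tree, so `energy /
volume` is the stationary mean of `weight`. -/
noncomputable def energy (ℓ : ℕ+) (s : TreeWalker) : ℝ := ∑ v, s.loopDegree ℓ v * s.weight v

/-- The solution of the Poisson equation for `weight` on the current tree, at the walker. -/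
noncomputable def corrector (ℓ : ℕ+) (s : TreeWalker) : ℝ :=
  -(1 / 2) * ∑ v, s.loopDegree ℓ v * (s.weight v - s.energy ℓ / s.volume ℓ)
    * s.graph.dist s.pos v

/-- A perturbation of `energy` that is nearly a supermartingale. -/
noncomputable def lyapunov (ℓ : ℕ+) (a : ℝ) (s : TreeWalker) : ℝ :=
  s.energy ℓ + a * s.corrector ℓ

variable (ℓ : ℕ+) (s : TreeWalker)

theorem card_neighbors : (Multiset.card (s.neighbors ℓ) : ℝ) = s.loopDegree ℓ s.pos := by
  classical
  rw [neighbors, Multiset.card_add, loopDegree]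
  split_ifs <;> simp

theorem one_le_loopDegree (v : Fin s.order) : 1 ≤ s.loopDegree ℓ v := by
  have h := card_neighbors ℓ { s with pos := v }
  have h2 : 1 ≤ Multiset.card (neighbors ℓ { s with pos := v }) :=
    Multiset.card_pos.2 (neighbors_ne_zero ℓ _)
  have h3 : s.loopDegree ℓ v = loopDegree ℓ { s with pos := v } v := rfl
  rw [h3, ← h]
  exact_mod_cast h2

theorem one_le_weight (v : Fin s.order) : 1 ≤ s.weight v :=
  one_le_pow₀ one_le_two

theorem order_pos : 0 < s.order := s.root.pos

theorem order_le_volume : (s.order : ℝ) ≤ s.volume ℓ := by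
  have := Finset.sum_le_sum (s := Finset.univ) fun v _ => s.one_le_loopDegree ℓ v
  simpa [volume] using this

theorem volume_pos : 0 < s.volume ℓ :=
  lt_of_lt_of_le (by exact_mod_cast s.order_pos) (s.order_le_volume ℓ)

theorem volume_le (hℓ : (ℓ : ℕ) ≤ 2) : s.volume ℓ ≤ 2 * s.order := by
  classical
  have h1 := s.graph.sum_degrees_eq_twice_card_edges
  have h2 := s.isTree.card_edgeFinset
  rw [Fintype.card_fin] at h2
  have h3 : ∑ v, (s.graph.degree v : ℝ) = 2 * s.graph.edgeFinset.card := by exact_mod_cast h1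
  have h4 : (s.graph.edgeFinset.card : ℝ) + 1 = s.order := by exact_mod_cast h2
  have h5 : ((ℓ : ℕ) : ℝ) ≤ 2 := by exact_mod_cast hℓ
  have h6 : s.volume ℓ = 2 * s.graph.edgeFinset.card + ((ℓ : ℕ) : ℝ) := by
    rw [volume, ← h3]
    simp_rw [loopDegree]
    rw [Finset.sum_add_distrib, Finset.sum_ite_eq' Finset.univ, if_pos (Finset.mem_univ _)]
  linarith

theorem loopDegree_mul_weight_nonneg (v : Fin s.order) : 0 ≤ s.loopDegree ℓ v * s.weight v :=
  mul_nonneg (zero_le_one.trans (s.one_le_loopDegree ℓ v))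
    (zero_le_one.trans (s.one_le_weight v))

theorem weight_le_energy (v : Fin s.order) : s.weight v ≤ s.energy ℓ :=
  (le_mul_of_one_le_left (zero_le_one.trans (s.one_le_weight v)) (s.one_le_loopDegree ℓ v)).trans
    (Finset.single_le_sum (f := fun v => s.loopDegree ℓ v * s.weight v)
      (fun v _ => s.loopDegree_mul_weight_nonneg ℓ v) (Finset.mem_univ v))

theorem energy_pos : 0 < s.energy ℓ :=
  zero_lt_one.trans_le ((s.one_le_weight s.pos).trans (s.weight_le_energy ℓ s.pos))

theorem energy_le_two_pow_diam_mul_volume :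
    s.energy ℓ ≤ 2 ^ s.graph.diam * s.volume ℓ := by
  rw [energy, volume, Finset.mul_sum]
  refine Finset.sum_le_sum fun v _ => ?_
  rw [mul_comm]
  have h1 := s.one_le_loopDegree ℓ v
  refine mul_le_mul_of_nonneg_right ?_ (by linarith)
  exact pow_le_pow_right₀ one_le_two (s.isTree.connected.dist_le_diam_of_finite _ _)

/-- By the triangle inequality through the root, one end of a diametral path has depth at least half
the diameter. -/
theorem two_rpow_diam_le_energy : (2 : ℝ) ^ ((s.graph.diam : ℝ) / 2) ≤ s.energy ℓ := by
  have : Nonempty (Fin s.order) := ⟨s.root⟩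
  obtain ⟨u, v, huv⟩ := s.graph.exists_dist_eq_diam
  have h := s.isTree.connected.dist_triangle (u := u) (v := s.root) (w := v)
  rw [huv, SimpleGraph.dist_comm (v := s.root)] at h
  have key : ∃ w, s.graph.diam ≤ 2 * s.graph.dist s.root w := by
    rcases le_total (s.graph.dist s.root u) (s.graph.dist s.root v) with h1 | h1
    · exact ⟨v, by omega⟩
    · exact ⟨u, by omega⟩
  obtain ⟨w, hw⟩ := key
  refine le_trans ?_ (s.weight_le_energy ℓ w)
  rw [weight, ← Real.rpow_natCast]
  refine Real.rpow_le_rpow_of_exponent_le one_le_two ?_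
  have : (s.graph.diam : ℝ) ≤ 2 * s.graph.dist s.root w := by exact_mod_cast hw
  linarith

theorem abs_corrector_le : |s.corrector ℓ| ≤ s.graph.diam * s.energy ℓ := by
  have hV := s.volume_pos ℓ
  have hE := s.energy_pos ℓ
  have hb : ∀ v, |s.loopDegree ℓ v * (s.weight v - s.energy ℓ / s.volume ℓ)
      * s.graph.dist s.pos v| ≤ (s.loopDegree ℓ v * s.weight v
        + s.loopDegree ℓ v * (s.energy ℓ / s.volume ℓ)) * s.graph.diam := by
    intro v
    have h1 := s.one_le_loopDegree ℓ v
    have h2 := s.one_le_weight v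
    have h3 : 0 ≤ s.energy ℓ / s.volume ℓ := by positivity
    have hd : (s.graph.dist s.pos v : ℝ) ≤ s.graph.diam := by
      exact_mod_cast s.isTree.connected.dist_le_diam_of_finite _ _
    rw [abs_mul, abs_mul, Nat.abs_cast, abs_of_nonneg (by linarith : 0 ≤ s.loopDegree ℓ v),
      ← mul_add]
    gcongr
    refine (abs_sub _ _).trans ?_
    rw [abs_of_nonneg h3, abs_of_nonneg (by linarith)]
  calc |s.corrector ℓ| = 1 / 2 * |∑ v, s.loopDegree ℓ v
        * (s.weight v - s.energy ℓ / s.volume ℓ) * s.graph.dist s.pos v| := by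
        rw [corrector, abs_mul, abs_neg, abs_of_pos (by norm_num : (0 : ℝ) < 1 / 2)]
    _ ≤ 1 / 2 * ∑ v, (s.loopDegree ℓ v * s.weight v
        + s.loopDegree ℓ v * (s.energy ℓ / s.volume ℓ)) * s.graph.diam := by
        gcongr
        exact (Finset.abs_sum_le_sum_abs _ _).trans (Finset.sum_le_sum fun v _ => hb v)
    _ = s.graph.diam * s.energy ℓ := by
        rw [← Finset.sum_mul, Finset.sum_add_distrib, ← Finset.sum_mul, ← energy, ← volume]
        field_simp
        ring

theorem sum_loopDegree_mul_centered :
    ∑ v, s.loopDegree ℓ v * (s.weight v - s.energy ℓ / s.volume ℓ) = 0 := by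
  have hV := (s.volume_pos ℓ).ne'
  simp_rw [mul_sub]
  rw [Finset.sum_sub_distrib, ← Finset.sum_mul, ← energy, ← volume]
  field_simp
  ring

-- Crossing the loop changes nothing, so the loop only enlarges the denominator. This is how both
-- loop conventions are treated at once.
open scoped Classical in
theorem walkExp_eq (F : TreeWalker → ℝ) :
    walkExp ℓ F s = F s + (∑ u ∈ s.graph.neighborFinset s.pos, (F { s with pos := u } - F s))
      / s.loopDegree ℓ s.pos := by
  have hd : s.loopDegree ℓ s.pos ≠ 0 := by linarith [s.one_le_loopDegree ℓ s.pos]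
  have hsum : ((s.neighbors ℓ).map fun u => F { s with pos := u }).sum
      = ∑ u ∈ s.graph.neighborFinset s.pos, F { s with pos := u }
        + if s.pos = s.root then ((ℓ : ℕ) : ℝ) * F s else 0 := by
    rw [neighbors, Multiset.map_add, Multiset.sum_add]
    congr 1
    split_ifs with h
    · have h2 : F { s with pos := s.root } = F s := by
        congr 1
        cases s
        dsimp only at h
        subst h
        rfl
      rw [Multiset.map_replicate, Multiset.sum_replicate, h2, nsmul_eq_mul]
    · simp
  rw [walkExp, card_neighbors, hsum, div_eq_iff hd, add_mul, div_mul_cancel₀ _ hd,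
    Finset.sum_sub_distrib, Finset.sum_const, card_neighborFinset_eq_degree, nsmul_eq_mul,
    loopDegree]
  split_ifs <;> ring

/-- The Poisson equation. Summing the distance identity against the centred charge `g` kills the
term `degree - 2`; the point mass leaves `2 * g s.pos`, and the factor `-(1 / 2)` and the division
by the degree turn it into minus the centred weight. -/
theorem walkExp_corrector :
    walkExp ℓ (corrector ℓ) s
      = s.corrector ℓ - s.weight s.pos + s.energy ℓ / s.volume ℓ := by
  classical
  have hd : s.loopDegree ℓ s.pos ≠ 0 := by linarith [s.one_le_loopDegree ℓ s.pos]
  set g : Fin s.order → ℝ :=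
    fun v => s.loopDegree ℓ v * (s.weight v - s.energy ℓ / s.volume ℓ) with hg
  have hg0 : ∑ v, g v = 0 := s.sum_loopDegree_mul_centered ℓ
  have hdiff : ∀ u, corrector ℓ { s with pos := u } - corrector ℓ s
      = -(1 / 2) * ∑ v, g v * ((s.graph.dist u v : ℝ) - s.graph.dist s.pos v) := by
    intro u
    simp_rw [mul_sub]
    rw [Finset.sum_sub_distrib]
    simp only [corrector, hg]
    exact (mul_sub _ _ _).symm
  have hsum : ∑ u ∈ s.graph.neighborFinset s.pos, (corrector ℓ { s with pos := u } - corrector ℓ s)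
      = - g s.pos := by
    simp_rw [hdiff]
    rw [← Finset.mul_sum, Finset.sum_comm]
    simp_rw [← Finset.mul_sum, s.isTree.sum_dist_neighborFinset, mul_add]
    rw [Finset.sum_add_distrib, ← Finset.sum_mul, hg0]
    simp
    ring
  rw [walkExp_eq, hsum, hg]
  field_simp
  ring

theorem walkExp_lyapunov (a : ℝ) :
    walkExp ℓ (lyapunov ℓ a) s
      = s.lyapunov ℓ a - a * s.weight s.pos + a * (s.energy ℓ / s.volume ℓ) := by
  have h : lyapunov ℓ a = energy ℓ + a • corrector ℓ := rfl
  rw [h, walkExp_add, walkExp_smul, walkExp_corrector,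
    walkExp_const_of_forall (c := s.energy ℓ) fun _ => rfl]
  simp only [Pi.add_apply, Pi.smul_apply, smul_eq_mul]
  ring

theorem weight_addLeaf_castSucc (v : Fin s.order) :
    s.addLeaf.weight v.castSucc = s.weight v := by
  exact congrArg (fun k => (2 : ℝ) ^ k) (leafGraph_dist_castSucc s.pos s.isTree s.root v)

theorem weight_addLeaf_last : s.addLeaf.weight (Fin.last s.order) = 2 * s.weight s.pos := by
  have := congrArg (fun k => (2 : ℝ) ^ k) (leafGraph_dist_last s.pos s.isTree s.root)
  exact this.trans (pow_succ' _ _)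

theorem loopDegree_addLeaf_castSucc (v : Fin s.order) :
    s.addLeaf.loopDegree ℓ v.castSucc = s.loopDegree ℓ v + if v = s.pos then 1 else 0 := by
  classical
  have h := congrArg (Nat.cast (R := ℝ)) (leafGraph_degree_castSucc (G := s.graph) s.pos v)
  change ((leafGraph s.graph s.pos).degree v.castSucc : ℝ)
    + (if v.castSucc = s.root.castSucc then ((ℓ : ℕ) : ℝ) else 0) = _
  simp only [Fin.castSucc_inj]
  push_cast at h
  rw [h, loopDegree]
  split_ifs <;> ring

theorem loopDegree_addLeaf_last : s.addLeaf.loopDegree ℓ (Fin.last s.order) = 1 := by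
  classical
  have h := leafGraph_degree_last (G := s.graph) s.pos
  change ((leafGraph s.graph s.pos).degree (Fin.last s.order) : ℝ)
    + (if Fin.last s.order = s.root.castSucc then ((ℓ : ℕ) : ℝ) else 0) = _
  rw [if_neg (Fin.castSucc_lt_last s.root).ne', h]
  simp

/-- The leaf has degree one and twice the weight of its parent, whose own degree grows by one: `2 +
1 = 3`. -/
theorem energy_addLeaf : s.addLeaf.energy ℓ = s.energy ℓ + 3 * s.weight s.pos := by
  have h : s.addLeaf.energy ℓ = ∑ v : Fin (s.order + 1),
    s.addLeaf.loopDegree ℓ v * s.addLeaf.weight v := rfl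
  rw [h, Fin.sum_univ_castSucc, loopDegree_addLeaf_last, weight_addLeaf_last]
  simp_rw [loopDegree_addLeaf_castSucc, weight_addLeaf_castSucc, add_mul, ite_mul, zero_mul]
  rw [Finset.sum_add_distrib, Finset.sum_ite_eq', if_pos (Finset.mem_univ _), energy]
  ring

theorem weight_addLeaf_pos : s.addLeaf.weight s.addLeaf.pos = s.weight s.pos :=
  s.weight_addLeaf_castSucc s.pos

theorem half_energy_le_lyapunov {a D : ℝ} (ha : 0 ≤ a) (hD : (s.graph.diam : ℝ) ≤ D)
    (haD : a * D ≤ 1 / 2) : s.energy ℓ / 2 ≤ s.lyapunov ℓ a := by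
  have h1 := (abs_le.1 (s.abs_corrector_le ℓ)).1
  have hE := s.energy_pos ℓ
  have h2 : a * (s.graph.diam * s.energy ℓ) ≤ 1 / 2 * s.energy ℓ := by
    rw [← mul_assoc]
    gcongr
    exact (mul_le_mul_of_nonneg_left hD ha).trans haD
  have h3 := mul_le_mul_of_nonneg_left h1 ha
  rw [lyapunov]
  linarith

theorem lyapunov_le {a D : ℝ} (ha : 0 ≤ a) (hD : (s.graph.diam : ℝ) ≤ D)
    (haD : a * D ≤ 1 / 2) : s.lyapunov ℓ a ≤ 2 * s.energy ℓ := by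
  have h1 := (abs_le.1 (s.abs_corrector_le ℓ)).2
  have hE := s.energy_pos ℓ
  have h2 : a * (s.graph.diam * s.energy ℓ) ≤ 1 / 2 * s.energy ℓ := by
    rw [← mul_assoc]
    gcongr
    exact (mul_le_mul_of_nonneg_left hD ha).trans haD
  have h3 := mul_le_mul_of_nonneg_left h1 ha
  rw [lyapunov]
  linarith

/-- The drift `-a * weight` of the corrector pays for the energy of a new leaf. What remains is the
stationary mean, of order `a / V`, and the change of the corrector caused by a leaf, of order `p * a
* D`. -/
theorem stepExp_lyapunov_le {p a D V : ℝ} (hp0 : 0 ≤ p) (hp : p ≤ 1 / 2) (hpa : 6 * p ≤ a)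
    (haD : a * (D + 1) ≤ 1 / 2) (hD : (s.graph.diam : ℝ) ≤ D) (hV0 : 0 < V)
    (hV : V ≤ s.order) :
    stepExp ℓ p (lyapunov ℓ a) s
      ≤ (1 + (2 * a / V + 10 * p * a * (D + 2))) * s.lyapunov ℓ a := by
  have ha : 0 ≤ a := by linarith
  have hD0 : 0 ≤ D := (Nat.cast_nonneg _).trans hD
  have hE := s.energy_pos ℓ
  have hw := s.weight_le_energy ℓ s.pos
  have hw1 := s.one_le_weight s.pos
  have hvol := s.order_le_volume ℓ
  have hvol' := s.addLeaf.order_le_volume ℓ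
  have hE' := s.energy_addLeaf ℓ
  have hE'0 := s.addLeaf.energy_pos ℓ
  have horder' : (1 : ℝ) ≤ s.addLeaf.order := by exact_mod_cast s.addLeaf.order_pos
  have hdiam' : (s.addLeaf.graph.diam : ℝ) ≤ D + 1 := by
    have : (s.addLeaf.graph.diam : ℝ) ≤ s.graph.diam + 1 := by
      exact_mod_cast leafGraph_diam_le s.pos s.isTree
    linarith
  have hr : s.energy ℓ / s.volume ℓ ≤ s.energy ℓ / V := by gcongr; linarith
  -- Discarding the volume is affordable here, since this term carries the extra factor `p * a`.
  have hr' : s.addLeaf.energy ℓ / s.addLeaf.volume ℓ ≤ 4 * s.energy ℓ := by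
    refine (div_le_self hE'0.le (by linarith)).trans (by linarith)
  have hc' : s.addLeaf.corrector ℓ ≤ (D + 1) * (4 * s.energy ℓ) := by
    refine ((abs_le.1 (s.addLeaf.abs_corrector_le ℓ)).2).trans ?_
    gcongr
    linarith
  have hc : -(D * s.energy ℓ) ≤ s.corrector ℓ := by
    refine le_trans (neg_le_neg ?_) (abs_le.1 (s.abs_corrector_le ℓ)).1
    gcongr
  have hlow := s.half_energy_le_lyapunov ℓ ha hD (by nlinarith)
  have hmove : walkExp ℓ (lyapunov ℓ a) s
      ≤ s.energy ℓ + a * s.corrector ℓ - a * s.weight s.pos + a * (s.energy ℓ / V) := by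
    rw [walkExp_lyapunov, lyapunov]
    gcongr
  have hleaf : walkExp ℓ (lyapunov ℓ a) s.addLeaf
      ≤ s.energy ℓ + 3 * s.weight s.pos + a * ((D + 1) * (4 * s.energy ℓ))
        + a * (4 * s.energy ℓ) := by
    rw [walkExp_lyapunov, lyapunov, hE', weight_addLeaf_pos, ← hE']
    have h1 := mul_le_mul_of_nonneg_left hc' ha
    have h2 := mul_le_mul_of_nonneg_left hr' ha
    have h3 : 0 ≤ a * s.weight s.pos := by positivity
    linarith
  have hb1 := mul_le_mul_of_nonneg_left hmove (by linarith : 0 ≤ 1 - p)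
  have hb2 := mul_le_mul_of_nonneg_left hleaf hp0
  have hb3 : p * a * (-(D * s.energy ℓ)) ≤ p * a * s.corrector ℓ :=
    mul_le_mul_of_nonneg_left hc (by positivity)
  -- The cancellation: `p ≤ 1 / 2` and `6 * p ≤ a` give `3 * p ≤ (1 - p) * a`.
  have hb4 : (3 * p - (1 - p) * a) * s.weight s.pos ≤ 0 :=
    mul_nonpos_of_nonpos_of_nonneg (by nlinarith) (by linarith)
  have hb5 : 0 ≤ p * (a * (s.energy ℓ / V)) := by positivity
  have hb6 : (2 * a / V + 10 * p * a * (D + 2)) * (s.energy ℓ / 2)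
      ≤ (2 * a / V + 10 * p * a * (D + 2)) * s.lyapunov ℓ a :=
    mul_le_mul_of_nonneg_left hlow (by positivity)
  have hb7 : (2 * a / V + 10 * p * a * (D + 2)) * (s.energy ℓ / 2)
      = a * (s.energy ℓ / V) + 5 * p * a * (D + 2) * s.energy ℓ := by ring
  have hb8 : 0 ≤ p * a * s.energy ℓ := by positivity
  have hL : s.lyapunov ℓ a = s.energy ℓ + a * s.corrector ℓ := rfl
  rw [stepExp, add_mul, one_mul]
  linarith

/-- `lyapunov`, killed when the diameter exceeds `D`. -/
noncomputable def killedLyapunov (ℓ : ℕ+) (a D : ℝ) : TreeWalker → ℝ :=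
  {s : TreeWalker | (s.graph.diam : ℝ) ≤ D}.indicator (lyapunov ℓ a)

/-- The diameter never decreases, so killing is permanent. One leaf overshoots `D` by at most one,
and `a * (D + 1) ≤ 1 / 2` keeps `lyapunov` nonnegative there, so killing only lowers it. -/
theorem stepExp_killedLyapunov_le {p a D V : ℝ} (hp0 : 0 ≤ p) (hp : p ≤ 1 / 2) (hpa : 6 * p ≤ a)
    (haD : a * (D + 1) ≤ 1 / 2) (hV0 : 0 < V) (hV : V ≤ s.order) :
    stepExp ℓ p (killedLyapunov ℓ a D) s
      ≤ (1 + (2 * a / V + 10 * p * a * (D + 2))) * killedLyapunov ℓ a D s := by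
  have ha : 0 ≤ a := by linarith
  have hmono : (s.graph.diam : ℝ) ≤ s.addLeaf.graph.diam := by
    exact_mod_cast leafGraph_diam_ge s.pos s.isTree
  have hle : ∀ t : TreeWalker, (t.graph.diam : ℝ) ≤ D + 1 →
      killedLyapunov ℓ a D t ≤ lyapunov ℓ a t := by
    intro t ht
    have h0 : 0 ≤ lyapunov ℓ a t := by
      have := t.energy_pos ℓ
      linarith [t.half_energy_le_lyapunov ℓ ha ht haD]
    exact Set.indicator_apply_le' (fun _ => le_rfl) fun _ => h0
  by_cases hD : (s.graph.diam : ℝ) ≤ D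
  · have hdiam' : (s.addLeaf.graph.diam : ℝ) ≤ D + 1 := by
      have : (s.addLeaf.graph.diam : ℝ) ≤ s.graph.diam + 1 := by
        exact_mod_cast leafGraph_diam_le s.pos s.isTree
      linarith
    rw [killedLyapunov, Set.indicator_of_mem (a := s) (by exact hD)]
    refine le_trans ?_ (s.stepExp_lyapunov_le ℓ hp0 hp hpa haD hD hV0 hV)
    exact add_le_add
      (mul_le_mul_of_nonneg_left (walkExp_mono fun u => hle _ (hD.trans (by linarith)))
        (by linarith))
      (mul_le_mul_of_nonneg_left (walkExp_mono fun u => hle _ hdiam') hp0)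
  · have h0 : ∀ t : TreeWalker, ¬ (t.graph.diam : ℝ) ≤ D → killedLyapunov ℓ a D t = 0 :=
      fun t ht => Set.indicator_of_notMem (s := {s : TreeWalker | (s.graph.diam : ℝ) ≤ D}) ht _
    have h1 : walkExp ℓ (killedLyapunov ℓ a D) s = 0 :=
      walkExp_const_of_forall fun u => h0 { s with pos := u } hD
    have h2 : walkExp ℓ (killedLyapunov ℓ a D) s.addLeaf = 0 :=
      walkExp_const_of_forall fun u => h0 { s.addLeaf with pos := u } fun h => hD (hmono.trans h)
    rw [h0 s hD, stepExp, h1, h2]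
    simp

theorem evolve_killedLyapunov_le {ℓ : ℕ+} {p : ℕ → ℝ} (hp01 : ∀ i, p i ∈ unitInterval)
    {q a D V : ℝ} {t : ℕ} (hq : ∀ i, t < i → p i ≤ q) (hq2 : q ≤ 1 / 2) (hqa : 6 * q ≤ a)
    (hD0 : 0 ≤ D) (haD : a * (D + 1) ≤ 1 / 2) (hV0 : 0 < V) (k : ℕ) (s : TreeWalker)
    (hV : V ≤ s.order) :
    evolve ℓ p t k (killedLyapunov ℓ a D) s
      ≤ (1 + (2 * a / V + 10 * q * a * (D + 2))) ^ k * killedLyapunov ℓ a D s := by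
  have hq0 : 0 ≤ q := (hp01 (t + 1)).1.trans (hq _ (Nat.lt_succ_self t))
  have ha : 0 ≤ a := by linarith
  set r := 1 + (2 * a / V + 10 * q * a * (D + 2)) with hr
  have hr0 : 0 ≤ r := by positivity
  have hL0 : 0 ≤ killedLyapunov ℓ a D := by
    intro s
    refine Set.indicator_nonneg (fun s hs => ?_) s
    have := s.energy_pos ℓ
    linarith [s.half_energy_le_lyapunov ℓ ha hs (by linarith)]
  induction k with
  | zero => simp [evolve]
  | succ k ih =>
    have hstep : ∀ s : TreeWalker, V ≤ s.order →
        stepExp ℓ (p (t + k + 1)) (killedLyapunov ℓ a D) s ≤ (r • killedLyapunov ℓ a D) s := by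
      intro s hs
      have hpq := hq (t + k + 1) (by omega)
      refine (s.stepExp_killedLyapunov_le ℓ (hp01 _).1 (hpq.trans hq2) (by linarith) haD hV0
        hs).trans ?_
      have h0 := (hp01 (t + k + 1)).1
      refine mul_le_mul_of_nonneg_right ?_ (hL0 s)
      rw [hr]
      gcongr
    rw [evolve]
    refine (evolve_mono_of_le_order hp01 t k hstep s hV).trans ?_
    rw [evolve_smul, pow_succ', mul_assoc]
    exact mul_le_mul_of_nonneg_left ih hr0

end TreeWalker

/-! ### Exponential moments of the size, and the diameter over a time window -/

namespace TreeWalker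

theorem walkExp_one (ℓ : ℕ+) (s : TreeWalker) : walkExp ℓ 1 s = 1 :=
  walkExp_const_of_forall fun _ => rfl

theorem stepExp_one (ℓ : ℕ+) (p : ℝ) : stepExp ℓ p 1 = 1 := by
  ext s
  simp [stepExp, walkExp_one]

theorem evolve_one (ℓ : ℕ+) (p : ℕ → ℝ) (t k : ℕ) : evolve ℓ p t k 1 = 1 := by
  induction k with
  | zero => rfl
  | succ k ih => rw [evolve, stepExp_one, ih]

theorem stepExp_pow_order (ℓ : ℕ+) (p c : ℝ) :
    stepExp ℓ p (fun s => c ^ s.order) = (1 + (c - 1) * p) • fun s => c ^ s.order := by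
  ext s
  have h1 : walkExp ℓ (fun s => c ^ s.order) s = c ^ s.order :=
    walkExp_const_of_forall fun _ => rfl
  have h2 : walkExp ℓ (fun s => c ^ s.order) s.addLeaf = c ^ (s.order + 1) :=
    walkExp_const_of_forall fun _ => rfl
  rw [stepExp, h1, h2, Pi.smul_apply, smul_eq_mul]
  ring

theorem evolve_pow_order_le {ℓ : ℕ+} {p : ℕ → ℝ} (hp : ∀ i, p i ∈ unitInterval) {c : ℝ}
    (hc : 0 ≤ c) (k : ℕ) (s : TreeWalker) :
    evolve ℓ p 0 k (fun s => c ^ s.order) s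
      ≤ Real.exp ((c - 1) * ∑ i ∈ Finset.range k, p (i + 1)) * c ^ s.order := by
  induction k with
  | zero => simp [evolve]
  | succ k ih =>
    have hle : stepExp ℓ (p (0 + k + 1)) (fun s => c ^ s.order)
        ≤ Real.exp ((c - 1) * p (k + 1)) • fun s : TreeWalker => c ^ s.order := by
      rw [stepExp_pow_order, zero_add]
      intro s
      simp only [Pi.smul_apply, smul_eq_mul]
      gcongr
      linarith [Real.add_one_le_exp ((c - 1) * p (k + 1))]
    rw [evolve]
    refine (evolve_mono hp 0 k hle s).trans ?_
    rw [evolve_smul, Finset.sum_range_succ, mul_add, add_comm (_ * _), Real.exp_add, mul_assoc]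
    exact mul_le_mul_of_nonneg_left ih (Real.exp_pos _).le

theorem evolve_order_le {ℓ : ℕ+} {p : ℕ → ℝ} (hp : ∀ i, p i ∈ unitInterval) (k : ℕ)
    (s : TreeWalker) :
    evolve ℓ p 0 k (fun s => (s.order : ℝ)) s ≤ s.order + k := by
  induction k with
  | zero => simp [evolve]
  | succ k ih =>
    have hle : stepExp ℓ (p (0 + k + 1)) (fun s => (s.order : ℝ))
        ≤ (fun s : TreeWalker => (s.order : ℝ)) + 1 := by
      intro s
      have h1 : walkExp ℓ (fun s => (s.order : ℝ)) s = s.order :=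
        walkExp_const_of_forall fun _ => rfl
      have h2 : walkExp ℓ (fun s => (s.order : ℝ)) s.addLeaf = ((s.order + 1 : ℕ) : ℝ) :=
        walkExp_const_of_forall fun _ => rfl
      rw [stepExp, h1, h2]
      have := (hp (0 + k + 1)).2
      push_cast
      simp only [Pi.add_apply, Pi.one_apply]
      linarith
    rw [evolve]
    refine (evolve_mono hp 0 k hle s).trans ?_
    rw [evolve_add, evolve_one]
    push_cast
    simp only [Pi.add_apply, Pi.one_apply]
    linarith

/-- A Chernoff bound with the exponential moment `(1 / 2) ^ order`. -/
theorem evolve_indicator_order_le {ℓ : ℕ+} {p : ℕ → ℝ} (hp : ∀ i, p i ∈ unitInterval)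
    (V : ℝ) (k : ℕ) (s : TreeWalker) :
    evolve ℓ p 0 k ({s : TreeWalker | (s.order : ℝ) ≤ V}.indicator 1) s
      ≤ 2 ^ V * Real.exp (-(1 / 2) * ∑ i ∈ Finset.range k, p (i + 1)) := by
  have hle : {s : TreeWalker | (s.order : ℝ) ≤ V}.indicator (1 : TreeWalker → ℝ)
      ≤ (2 : ℝ) ^ V • fun s : TreeWalker => (1 / 2 : ℝ) ^ s.order := by
    intro s
    refine Set.indicator_apply_le' (fun hs => ?_) fun _ => ?_
    · have h : (2 : ℝ) ^ s.order ≤ 2 ^ V := by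
        rw [← Real.rpow_natCast]
        exact Real.rpow_le_rpow_of_exponent_le one_le_two hs
      simp only [Pi.one_apply, Pi.smul_apply, smul_eq_mul, one_div, inv_pow]
      rwa [← div_eq_mul_inv, one_le_div (by positivity)]
    · simp only [Pi.smul_apply, smul_eq_mul]
      positivity
  refine (evolve_mono hp 0 k hle s).trans ?_
  rw [evolve_smul]
  simp only [Pi.smul_apply, smul_eq_mul]
  gcongr
  refine (evolve_pow_order_le hp (by norm_num) k s).trans ?_
  refine (mul_le_of_le_one_right (Real.exp_pos _).le
    (pow_le_one₀ (by norm_num) (by norm_num))).trans (Eq.le ?_)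
  norm_num

theorem diam_le_order (s : TreeWalker) : s.graph.diam ≤ s.order := by
  have : Nonempty (Fin s.order) := ⟨s.root⟩
  obtain ⟨u, v, huv⟩ := s.graph.exists_dist_eq_diam
  obtain ⟨p, hp, hl⟩ := (s.isTree.connected u v).exists_path_of_dist
  have := hp.length_lt
  rw [Fintype.card_fin] at this
  omega

theorem evolve_indicator_diam_le_exp {ℓ : ℕ+} {p : ℕ → ℝ} (hp : ∀ i, p i ∈ unitInterval)
    (A : ℝ) (k : ℕ) (s : TreeWalker) :
    evolve ℓ p 0 k ({s : TreeWalker | A ≤ s.graph.diam}.indicator 1) s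
      ≤ 2 ^ (-A) * (Real.exp (∑ i ∈ Finset.range k, p (i + 1)) * 2 ^ s.order) := by
  have hle : {s : TreeWalker | A ≤ s.graph.diam}.indicator (1 : TreeWalker → ℝ)
      ≤ (2 : ℝ) ^ (-A) • fun s : TreeWalker => (2 : ℝ) ^ s.order := by
    intro s
    refine Set.indicator_apply_le' (fun hs => ?_) fun _ => ?_
    · have h : (2 : ℝ) ^ A ≤ 2 ^ s.order := by
        rw [← Real.rpow_natCast]
        refine Real.rpow_le_rpow_of_exponent_le one_le_two (le_trans hs ?_)
        exact_mod_cast s.diam_le_order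
      simp only [Pi.one_apply, Pi.smul_apply, smul_eq_mul]
      rw [Real.rpow_neg zero_le_two, ← div_eq_inv_mul, one_le_div (by positivity)]
      exact h
    · simp only [Pi.smul_apply, smul_eq_mul]
      positivity
  refine (evolve_mono hp 0 k hle s).trans ?_
  rw [evolve_smul]
  simp only [Pi.smul_apply, smul_eq_mul]
  gcongr
  refine (evolve_pow_order_le hp (by norm_num) k s).trans (Eq.le ?_)
  norm_num

/-- On a tree with at least `V` vertices, the diameter is unlikely to become large while staying
below the a priori bound `D`. -/
theorem evolve_indicator_diam_mem_Icc_le {ℓ : ℕ+} (hℓ : (ℓ : ℕ) ≤ 2) {p : ℕ → ℝ}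
    (hp : ∀ i, p i ∈ unitInterval) {q D V : ℝ} {t : ℕ} (hq : ∀ i, t < i → p i ≤ q)
    (hq2 : q ≤ 1 / 2) (hD0 : 0 ≤ D) (hqD : 6 * q * (D + 1) ≤ 1 / 2) (hV0 : 0 < V) (A : ℝ) (k : ℕ)
    (s : TreeWalker) (hV : V ≤ s.order) :
    evolve ℓ p t k ({s : TreeWalker | A ≤ s.graph.diam ∧ s.graph.diam ≤ D}.indicator 1) s
      ≤ 8 * (2 ^ (-(A / 2)) * 2 ^ s.graph.diam
        * Real.exp (k * (12 * q / V + 60 * q ^ 2 * (D + 2)))) * s.order := by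
  have hq0 : 0 ≤ q := (hp (t + 1)).1.trans (hq _ (Nat.lt_succ_self t))
  have h6q : 0 ≤ 6 * q := by linarith
  have hqD' : 6 * q * D ≤ 1 / 2 := by linarith
  have hle : {s : TreeWalker | A ≤ s.graph.diam ∧ s.graph.diam ≤ D}.indicator
      (1 : TreeWalker → ℝ) ≤ (2 * 2 ^ (-(A / 2)) : ℝ) • killedLyapunov ℓ (6 * q) D := by
    intro s
    have hL0 : 0 ≤ killedLyapunov ℓ (6 * q) D s := by
      refine Set.indicator_nonneg (fun s hs => ?_) s
      have := s.energy_pos ℓ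
      linarith [s.half_energy_le_lyapunov ℓ h6q hs hqD']
    refine Set.indicator_apply_le' (fun hs => ?_) fun _ => ?_
    · have h1 : killedLyapunov ℓ (6 * q) D s = s.lyapunov ℓ (6 * q) :=
        Set.indicator_of_mem (s := {s : TreeWalker | (s.graph.diam : ℝ) ≤ D}) hs.2 _
      have h2 := s.half_energy_le_lyapunov ℓ h6q hs.2 hqD'
      have h3 := s.two_rpow_diam_le_energy ℓ
      have h4 : (2 : ℝ) ^ (A / 2) ≤ 2 ^ ((s.graph.diam : ℝ) / 2) :=
        Real.rpow_le_rpow_of_exponent_le one_le_two (by linarith [hs.1])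
      simp only [Pi.one_apply, Pi.smul_apply, smul_eq_mul]
      rw [h1, Real.rpow_neg zero_le_two, mul_right_comm, ← div_eq_mul_inv,
        one_le_div (by positivity)]
      linarith
    · simp only [Pi.smul_apply, smul_eq_mul]
      positivity
  have hfin : killedLyapunov ℓ (6 * q) D s ≤ 4 * (2 ^ s.graph.diam * s.order) := by
    refine Set.indicator_apply_le' (fun hs => ?_) fun _ => by positivity
    refine (s.lyapunov_le ℓ h6q hs hqD').trans ?_
    have h1 := s.energy_le_two_pow_diam_mul_volume ℓ
    have h2 := mul_le_mul_of_nonneg_left (s.volume_le ℓ hℓ)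
      (by positivity : (0 : ℝ) ≤ 2 ^ s.graph.diam)
    linarith
  have hx : 0 ≤ 12 * q / V + 60 * q ^ 2 * (D + 2) := by positivity
  have hexp : (1 + (2 * (6 * q) / V + 10 * q * (6 * q) * (D + 2))) ^ k
      ≤ Real.exp (k * (12 * q / V + 60 * q ^ 2 * (D + 2))) := by
    rw [Real.exp_nat_mul]
    have h0 : 2 * (6 * q) / V + 10 * q * (6 * q) * (D + 2)
        = 12 * q / V + 60 * q ^ 2 * (D + 2) := by ring
    rw [h0]
    exact pow_le_pow_left₀ (by positivity)
      (by linarith [Real.add_one_le_exp (12 * q / V + 60 * q ^ 2 * (D + 2))]) k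
  refine (evolve_mono hp t k hle s).trans ?_
  rw [evolve_smul, Pi.smul_apply, smul_eq_mul]
  have h1 := evolve_killedLyapunov_le (ℓ := ℓ) hp hq hq2 le_rfl hD0 hqD hV0 k s hV
  calc _ ≤ 2 * 2 ^ (-(A / 2)) * (Real.exp (k * (12 * q / V + 60 * q ^ 2 * (D + 2)))
        * (4 * (2 ^ s.graph.diam * s.order))) := by
        refine mul_le_mul_of_nonneg_left (h1.trans ?_) (by positivity)
        refine (mul_le_mul_of_nonneg_left hfin (by positivity)).trans ?_
        exact mul_le_mul_of_nonneg_right hexp (by positivity)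
    _ = _ := by ring

/-- Four ways to reach diameter `A` at time `n`: exceed the a priori bound `D`, have diameter at
least `B` at time `t`, have at most `V` vertices at time `t`, or grow from a good tree while staying
below `D`, which the Lyapunov estimate controls. -/
theorem evolve_indicator_diam_le {ℓ : ℕ+} (hℓ : (ℓ : ℕ) ≤ 2) {p : ℕ → ℝ}
    (hp : ∀ i, p i ∈ unitInterval) {q D V : ℝ} {t n : ℕ} (htn : t ≤ n)
    (hq : ∀ i, t < i → p i ≤ q) (hq2 : q ≤ 1 / 2) (hD0 : 0 ≤ D)
    (hqD : 6 * q * (D + 1) ≤ 1 / 2) (hV0 : 0 < V) (A B : ℝ) (s : TreeWalker) :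
    evolve ℓ p 0 n ({s : TreeWalker | A ≤ s.graph.diam}.indicator 1) s
      ≤ evolve ℓ p 0 n ({s : TreeWalker | D ≤ s.graph.diam}.indicator 1) s
        + evolve ℓ p 0 t ({s : TreeWalker | B ≤ s.graph.diam}.indicator 1) s
        + evolve ℓ p 0 t ({s : TreeWalker | (s.order : ℝ) ≤ V}.indicator 1) s
        + 8 * (2 ^ (-(A / 2)) * 2 ^ B
          * Real.exp (n * (12 * q / V + 60 * q ^ 2 * (D + 2)))) * (s.order + n) := by
  have hq0 : 0 ≤ q := (hp (t + 1)).1.trans (hq _ (Nat.lt_succ_self t))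
  set c := 8 * ((2 : ℝ) ^ (-(A / 2)) * 2 ^ B
    * Real.exp (n * (12 * q / V + 60 * q ^ 2 * (D + 2)))) with hc
  have hc0 : 0 ≤ c := by positivity
  obtain ⟨k, rfl⟩ := Nat.exists_eq_add_of_le htn
  have h1 : {s : TreeWalker | A ≤ s.graph.diam}.indicator (1 : TreeWalker → ℝ)
      ≤ {s : TreeWalker | D ≤ s.graph.diam}.indicator 1
        + {s : TreeWalker | A ≤ s.graph.diam ∧ s.graph.diam ≤ D}.indicator 1 := by
    intro s
    simp only [Pi.add_apply, Set.indicator_apply, Set.mem_ofPred_eq, Pi.one_apply]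
    rcases le_total D s.graph.diam with h | h
    · rw [if_pos h]; split_ifs <;> norm_num
    · simp only [h, and_true]; split_ifs <;> norm_num
  have h2 : evolve ℓ p (0 + t) k
        ({s : TreeWalker | A ≤ s.graph.diam ∧ s.graph.diam ≤ D}.indicator 1)
      ≤ {s : TreeWalker | B ≤ s.graph.diam}.indicator 1
        + {s : TreeWalker | (s.order : ℝ) ≤ V}.indicator 1
        + c • fun s : TreeWalker => (s.order : ℝ) := by
    intro s
    simp only [Pi.add_apply, Pi.smul_apply, smul_eq_mul]
    have hU1 : evolve ℓ p (0 + t) k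
        ({s : TreeWalker | A ≤ s.graph.diam ∧ s.graph.diam ≤ D}.indicator 1) s ≤ 1 := by
      have hle : {s : TreeWalker | A ≤ s.graph.diam ∧ s.graph.diam ≤ D}.indicator
          (1 : TreeWalker → ℝ) ≤ 1 :=
        Set.indicator_le_self' fun _ _ => zero_le_one
      exact (evolve_mono hp _ _ hle s).trans_eq (congrFun (evolve_one ℓ p _ _) s)
    have hi : ∀ S : Set TreeWalker, 0 ≤ S.indicator (1 : TreeWalker → ℝ) s :=
      fun S => Set.indicator_nonneg (fun _ _ => zero_le_one) s
    have ho : 0 ≤ c * s.order := by positivity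
    by_cases hB : B ≤ s.graph.diam
    · have := Set.indicator_of_mem (s := {s : TreeWalker | B ≤ s.graph.diam}) (a := s) hB
        (1 : TreeWalker → ℝ)
      rw [this]
      simp only [Pi.one_apply]
      linarith [hi {s : TreeWalker | (s.order : ℝ) ≤ V}]
    by_cases hV : (s.order : ℝ) ≤ V
    · have := Set.indicator_of_mem (s := {s : TreeWalker | (s.order : ℝ) ≤ V}) (a := s) hV
        (1 : TreeWalker → ℝ)
      rw [this]
      simp only [Pi.one_apply]
      linarith [hi {s : TreeWalker | B ≤ s.graph.diam}]
    have h3 := evolve_indicator_diam_mem_Icc_le hℓ hp (t := 0 + t) (by simpa using hq) hq2 hD0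
      hqD hV0 A k s (not_le.1 hV).le
    have h4 : (2 : ℝ) ^ s.graph.diam ≤ 2 ^ B := by
      rw [← Real.rpow_natCast]
      exact Real.rpow_le_rpow_of_exponent_le one_le_two (not_le.1 hB).le
    have h5 : 8 * ((2 : ℝ) ^ (-(A / 2)) * 2 ^ s.graph.diam
        * Real.exp (k * (12 * q / V + 60 * q ^ 2 * (D + 2)))) * s.order ≤ c * s.order := by
      rw [hc]
      gcongr
      omega
    linarith [hi {s : TreeWalker | B ≤ s.graph.diam},
      hi {s : TreeWalker | (s.order : ℝ) ≤ V}]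
  refine (evolve_mono hp 0 _ h1 s).trans ?_
  rw [evolve_add, Pi.add_apply, evolve_add_time 0 t k
    ({s : TreeWalker | A ≤ s.graph.diam ∧ s.graph.diam ≤ D}.indicator 1)]
  have h6 := evolve_mono (ℓ := ℓ) hp 0 t h2 s
  rw [evolve_add, evolve_add, evolve_smul] at h6
  simp only [Pi.add_apply, Pi.smul_apply, smul_eq_mul] at h6
  have h7 := mul_le_mul_of_nonneg_left (evolve_order_le (ℓ := ℓ) hp t s) hc0
  have h8 : c * (s.order + t) ≤ c * (s.order + (t + k : ℕ)) := by
    gcongr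
  linarith

end TreeWalker

/-! ### Power asymptotics and the bootstrap on the exponent -/

namespace TreeWalker
open Filter

theorem eventually_exp_neg_mul_rpow_le {b c : ℝ} (hb : 0 < b) (hc : 0 < c) (M : ℝ) :
    ∀ᶠ n : ℕ in atTop, Real.exp (-c * (n : ℝ) ^ b) ≤ (n : ℝ) ^ (-M) := by
  have h1 := (isLittleO_exp_neg_mul_rpow_atTop hc (-M / b)).bound one_pos
  have h2 : Tendsto (fun n : ℕ => (n : ℝ) ^ b) atTop atTop :=
    (tendsto_rpow_atTop hb).comp tendsto_natCast_atTop_atTop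
  filter_upwards [h2.eventually h1, eventually_gt_atTop 0] with n hn hn0
  have hn1 : (0 : ℝ) ≤ n := n.cast_nonneg
  rw [← Real.rpow_mul hn1, mul_div_cancel₀ _ hb.ne', one_mul, Real.norm_of_nonneg (by positivity),
    Real.norm_of_nonneg (by positivity)] at hn
  exact hn

theorem eventually_mul_rpow_neg_le {b : ℝ} (hb : 0 < b) (c d : ℝ) (hd : 0 < d) :
    ∀ᶠ n : ℕ in atTop, c * (n : ℝ) ^ (-b) ≤ d := by
  have h : Tendsto (fun n : ℕ => c * (n : ℝ) ^ (-b)) atTop (nhds (c * 0)) :=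
    ((tendsto_rpow_neg_atTop hb).comp tendsto_natCast_atTop_atTop).const_mul c
  rw [mul_zero] at h
  exact h.eventually_le_const hd

/-- Induction on `n`; Bernoulli's inequality for the concave power `1 - γ` bounds each summand by an
increment of the right-hand side. -/
theorem sum_rpow_neg_le {γ : ℝ} (hγ0 : 0 ≤ γ) (hγ : γ < 1) (n : ℕ) :
    ∑ i ∈ Finset.range n, ((i + 1 : ℕ) : ℝ) ^ (-γ) ≤ (n : ℝ) ^ (1 - γ) / (1 - γ) := by
  have h1 : 0 < 1 - γ := by linarith
  induction n with
  | zero => simp [Real.zero_rpow h1.ne']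
  | succ n ih =>
    rw [Finset.sum_range_succ]
    refine (add_le_add_left ih _).trans ?_
    rw [← le_sub_iff_add_le', ← sub_div, le_div_iff₀ h1]
    set x : ℝ := ((n + 1 : ℕ) : ℝ) with hx
    have hx1 : 1 ≤ x := by rw [hx]; exact_mod_cast Nat.le_add_left 1 n
    have hx0 : 0 < x := by linarith
    have hn : (n : ℝ) = x * (1 + -1 / x) := by
      rw [hx]; push_cast; field_simp; ring
    have hb : (1 + -1 / x) ^ (1 - γ) ≤ 1 + (1 - γ) * (-1 / x) := by
      refine rpow_one_add_le_one_add_mul_self ?_ h1.le (by linarith)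
      rw [neg_div, neg_le_neg_iff, div_le_one hx0]
      exact hx1
    have h0 : 0 ≤ 1 + -1 / x := by
      rw [neg_div, ← sub_eq_add_neg, sub_nonneg, div_le_one hx0]
      exact hx1
    rw [hn, Real.mul_rpow hx0.le h0]
    have h2 : x ^ (1 - γ) = x * x ^ (-γ) := by
      rw [sub_eq_add_neg, Real.rpow_add hx0, Real.rpow_one]
    have h3 := mul_le_mul_of_nonneg_left hb (Real.rpow_nonneg hx0.le (1 - γ))
    have h4 : x ^ (1 - γ) * (1 + (1 - γ) * (-1 / x))
        = x ^ (1 - γ) - x ^ (-γ) * (1 - γ) := by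
      rw [h2]; field_simp; ring
    linarith

theorem rpow_le_sum_rpow_neg {γ : ℝ} (hγ0 : 0 ≤ γ) (hγ : γ < 1) (n : ℕ) :
    (n : ℝ) ^ (1 - γ) ≤ ∑ i ∈ Finset.range n, ((i + 1 : ℕ) : ℝ) ^ (-γ) := by
  rcases n.eq_zero_or_pos with rfl | hn
  · simp [Real.zero_rpow (sub_pos.2 hγ).ne']
  have hn0 : (0 : ℝ) < n := by exact_mod_cast hn
  have h : ∀ i ∈ Finset.range n, (n : ℝ) ^ (-γ) ≤ ((i + 1 : ℕ) : ℝ) ^ (-γ) := by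
    intro i hi
    have hi' := Finset.mem_range.1 hi
    exact Real.rpow_le_rpow_of_nonpos (by positivity) (by exact_mod_cast hi') (by linarith)
  have := Finset.card_nsmul_le_sum _ _ _ h
  rw [Finset.card_range, nsmul_eq_mul] at this
  rwa [sub_eq_add_neg, Real.rpow_add hn0, Real.rpow_one]

/-- The diameter at time `n` is `O(n ^ e)` up to a superpolynomially small probability, for all
starting trees with `m` vertices. -/
def HasDiamTail (γ : ℝ) (m : ℕ) (e : ℝ) : Prop :=
  ∀ M : ℝ, 0 < M → ∃ C : ℝ, 0 < C ∧ ∀ᶠ n : ℕ in atTop, ∀ ℓ : ℕ+, (ℓ : ℕ) ≤ 2 →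
    ∀ s : TreeWalker, s.order = m →
      evolve ℓ (fun i => (i : ℝ) ^ (-γ)) 0 n
        ({s : TreeWalker | C * (n : ℝ) ^ e ≤ s.graph.diam}.indicator 1) s ≤ (n : ℝ) ^ (-M)

theorem HasDiamTail.mono {γ : ℝ} (hγ : 0 ≤ γ) {m : ℕ} {e e' : ℝ} (h : HasDiamTail γ m e)
    (hee : e ≤ e') : HasDiamTail γ m e' := by
  intro M hM
  obtain ⟨C, hC, hev⟩ := h M hM
  refine ⟨C, hC, ?_⟩
  filter_upwards [hev, eventually_ge_atTop 1] with n hn hn1 ℓ hℓ s hs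
  refine (evolve_mono (natCast_rpow_neg_mem_unitInterval hγ) _ _ ?_ s).trans (hn ℓ hℓ s hs)
  have hn1' : (1 : ℝ) ≤ n := by exact_mod_cast hn1
  have hle : C * (n : ℝ) ^ e ≤ C * (n : ℝ) ^ e' := by gcongr
  exact Set.indicator_le_indicator_of_subset
    (fun t (ht : C * (n : ℝ) ^ e' ≤ t.graph.diam) => hle.trans ht) fun _ => zero_le_one

/-- The diameter is at most the number of vertices, whose mean increase `O(n ^ (1 - γ))` is `O(n ^
(1 / 2))`; an exponential moment concludes. -/
theorem hasDiamTail_half {γ : ℝ} (hγ : 1 / 2 < γ) (hγ' : γ < 1) (m : ℕ) :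
    HasDiamTail γ m (1 / 2) := by
  intro M hM
  have h1 : 0 < 1 - γ := by linarith
  have hl : 0 < Real.log 2 := Real.log_pos one_lt_two
  refine ⟨(1 / (1 - γ) + 1) / Real.log 2, by positivity, ?_⟩
  filter_upwards [eventually_exp_neg_mul_rpow_le one_half_pos one_pos (M + 1),
    eventually_ge_atTop (2 ^ m), eventually_ge_atTop 1] with n hn hnm hn1 ℓ hℓ s hs
  have hn1' : (1 : ℝ) ≤ n := by exact_mod_cast hn1
  have hn0 : (0 : ℝ) < n := by linarith
  have hnm' : (2 : ℝ) ^ m ≤ n := by exact_mod_cast hnm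
  refine (evolve_indicator_diam_le_exp (natCast_rpow_neg_mem_unitInterval (by linarith)) _ n
    s).trans ?_
  have hsum : ∑ i ∈ Finset.range n, ((i + 1 : ℕ) : ℝ) ^ (-γ)
      ≤ 1 / (1 - γ) * (n : ℝ) ^ (1 / 2 : ℝ) := by
    refine (sum_rpow_neg_le (by linarith) hγ' n).trans ?_
    rw [div_eq_inv_mul, ← one_div]
    gcongr
    linarith
  rw [hs, ← mul_assoc, Real.rpow_def_of_pos two_pos, ← Real.exp_add]
  calc _ ≤ Real.exp (-1 * (n : ℝ) ^ (1 / 2 : ℝ)) * n := by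
        gcongr
        have : Real.log 2 * -((1 / (1 - γ) + 1) / Real.log 2 * (n : ℝ) ^ (1 / 2 : ℝ))
          = -((1 / (1 - γ) + 1) * (n : ℝ) ^ (1 / 2 : ℝ)) := by field_simp
        rw [this]
        linarith
    _ ≤ (n : ℝ) ^ (-(M + 1)) * n := by gcongr
    _ = (n : ℝ) ^ (-M) := by
        rw [← Real.rpow_add_one hn0.ne']
        congr 1
        ring

/-- With `x` in the role of the starting time `t` and `N = n ^ ((1 - η) * e)`, the initial diameter
costs `2 ^ (2 * C * N)`, the volume term `exp (48 * N)` and the corrector term `exp (60 * (C + 2) *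
N)`. The threshold constant is chosen to beat all three and leave `exp (-N)`. -/
theorem exp_window_le {n x γ η e C : ℝ} (hn1 : 1 ≤ n) (hlow : n ^ (1 - η) ≤ x)
    (hup : x ≤ 2 * n ^ (1 - η)) (hγ0 : 0 ≤ γ) (hγ1 : γ ≤ 1) (he0 : 0 ≤ e) (he : e ≤ 1 / 2)
    (hC : 0 ≤ C) (hη : 0 ≤ η)
    (hηγ : 3 * η ≤ 2 * γ - 1) (hηe : η ≤ (1 - η) * e) :
    (2 : ℝ) ^ (-(2 * (2 * C + (48 + 60 * (C + 2) + 1) / Real.log 2) * n ^ ((1 - η) * e) / 2))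
        * 2 ^ (C * x ^ e)
        * Real.exp (n * (12 * x ^ (-γ) / (x ^ (1 - γ) / 4)
          + 60 * (x ^ (-γ)) ^ 2 * (C * n ^ e + 2)))
      ≤ Real.exp (-1 * n ^ ((1 - η) * e)) := by
  have hn0 : 0 < n := by linarith
  have hx0 : 0 < x := (Real.rpow_pos_of_pos hn0 _).trans_le hlow
  have hl : 0 < Real.log 2 := Real.log_pos one_lt_two
  have hne1 : 1 ≤ n ^ e := Real.one_le_rpow hn1 he0
  have hneg : ∀ y : ℝ, 0 ≤ y → x ^ (-y) ≤ n ^ (-((1 - η) * y)) := by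
    intro y hy
    rw [← mul_neg, Real.rpow_mul hn0.le]
    exact Real.rpow_le_rpow_of_nonpos (by positivity) hlow (by linarith)
  set N : ℝ := n ^ ((1 - η) * e) with hN
  have hN0 : 0 < N := by positivity
  have hxe : x ^ e ≤ 2 * N := by
    calc x ^ e ≤ (2 * n ^ (1 - η)) ^ e := Real.rpow_le_rpow hx0.le hup he0
      _ = 2 ^ e * N := by
          rw [Real.mul_rpow zero_le_two (by positivity), ← Real.rpow_mul hn0.le]
      _ ≤ 2 ^ (1 : ℝ) * N := by
          gcongr
          · exact one_le_two
          · linarith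
      _ = 2 * N := by rw [Real.rpow_one]
  have h1 : n * (12 * x ^ (-γ) / (x ^ (1 - γ) / 4)) ≤ 48 * N := by
    have h2 : x ^ (-1 : ℝ) = x ^ (-γ) / x ^ (1 - γ) := by
      rw [← Real.rpow_sub hx0]
      congr 1
      ring
    have h3 : 12 * x ^ (-γ) / (x ^ (1 - γ) / 4) = 48 * x ^ (-1 : ℝ) := by
      rw [h2]
      field_simp
      norm_num
    have h4 : n * n ^ (-((1 - η) * 1)) ≤ N := by
      rw [mul_comm, ← Real.rpow_add_one hn0.ne']
      exact Real.rpow_le_rpow_of_exponent_le hn1 (by linarith)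
    have h5 := mul_le_mul_of_nonneg_left (hneg 1 zero_le_one) hn0.le
    rw [h3]
    linarith
  have h2 : n * (60 * (x ^ (-γ)) ^ 2 * (C * n ^ e + 2)) ≤ 60 * (C + 2) * N := by
    calc n * (60 * (x ^ (-γ)) ^ 2 * (C * n ^ e + 2))
        ≤ n * (60 * (n ^ (-((1 - η) * γ))) ^ 2 * ((C + 2) * n ^ e)) := by
          gcongr
          · exact hneg γ hγ0
          · linarith
      _ = 60 * (C + 2) * (n ^ (1 : ℝ) * (n ^ (-((1 - η) * γ)) * n ^ (-((1 - η) * γ)))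
          * n ^ e) := by
          rw [Real.rpow_one]; ring
      _ = 60 * (C + 2) * n ^ (1 + (-((1 - η) * γ) + -((1 - η) * γ)) + e) := by
          rw [← Real.rpow_add hn0, ← Real.rpow_add hn0, ← Real.rpow_add hn0]
      _ ≤ 60 * (C + 2) * N := by
          refine mul_le_mul_of_nonneg_left
            (Real.rpow_le_rpow_of_exponent_le hn1 ?_) (by positivity)
          have h3 : η * γ ≤ η := mul_le_of_le_one_right hη hγ1
          -- The exponents compare once `2 * η * γ + η * e ≤ 2 * γ - 1`; the left side is at most `5
          -- / 2 * η`, whence the assumption on `3 * η`.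
          have h4 : η * e ≤ η * (1 / 2) := mul_le_mul_of_nonneg_left he hη
          linarith
  rw [Real.rpow_def_of_pos two_pos, Real.rpow_def_of_pos two_pos, ← Real.exp_add,
    ← Real.exp_add, Real.exp_le_exp, mul_add n]
  have h3 : Real.log 2 * -(2 * (2 * C + (48 + 60 * (C + 2) + 1) / Real.log 2) * N / 2)
      = -(Real.log 2 * (C * (2 * N))) - (48 + 60 * (C + 2) + 1) * N := by
    field_simp
    ring
  have h4 : Real.log 2 * (C * x ^ e) ≤ Real.log 2 * (C * (2 * N)) := by gcongr
  rw [h3]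
  linarith

theorem HasDiamTail.improve {γ : ℝ} (hγ : 1 / 2 < γ) (hγ' : γ < 1) {m : ℕ} {e η : ℝ}
    (h : HasDiamTail γ m e) (he : e ≤ 1 / 2) (hη : 0 < η) (hηγ : 3 * η ≤ 2 * γ - 1)
    (hηe : η ≤ (1 - η) * e) : HasDiamTail γ m ((1 - η) * e) := by
  have hγ0 : 0 ≤ γ := by linarith
  have hη1 : η < 1 / 3 := by linarith
  have he0 : 0 < e := pos_of_mul_pos_right (hη.trans_le hηe) (by linarith)
  have hl : 0 < Real.log 2 := Real.log_pos one_lt_two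
  have hp := natCast_rpow_neg_mem_unitInterval hγ0
  intro M hM
  -- The rate is doubled because the hypothesis is also used at time `t n ≥ n ^ (1 - η)`, where `1 -
  -- η ≥ 1 / 2`.
  obtain ⟨C₁, hC₁, hev⟩ := h (2 * (M + 1)) (by linarith)
  obtain ⟨C, hC⟩ : ∃ C, C = 2 * (2 * C₁ + (48 + 60 * (C₁ + 2) + 1) / Real.log 2) := ⟨_, rfl⟩
  refine ⟨C, by rw [hC]; positivity, ?_⟩
  let t : ℕ → ℕ := fun n => ⌈(n : ℝ) ^ (1 - η)⌉₊
  have ht_ge : ∀ n : ℕ, (n : ℝ) ^ (1 - η) ≤ t n := fun n => Nat.le_ceil _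
  have ht_top : Tendsto t atTop atTop := by
    refine tendsto_nat_ceil_atTop.comp ?_
    exact (tendsto_rpow_atTop (by linarith)).comp tendsto_natCast_atTop_atTop
  -- This makes `q * D` tend to `0`, so that energy and Lyapunov function are comparable.
  have hgap : 0 < γ * (1 - η) - e := by nlinarith
  filter_upwards [hev, ht_top.eventually hev,
    eventually_exp_neg_mul_rpow_le (b := (1 - η) * (1 - γ)) (c := 1 / 4)
      (mul_pos (by linarith) (by linarith)) (by norm_num) (M + 1),
    eventually_exp_neg_mul_rpow_le (b := (1 - η) * e) (c := 1)
      (by linarith) one_pos (M + 3),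
    eventually_mul_rpow_neg_le (b := (1 - η) * γ) (mul_pos (by linarith) (by linarith))
      1 (1 / 2) one_half_pos,
    eventually_mul_rpow_neg_le hgap (6 * (C₁ + 1)) (1 / 2) one_half_pos,
    eventually_ge_atTop 4, eventually_ge_atTop (8 * (m + 1))]
    with n hD hB hexp hexp' hq2 hqD hn4 hnm ℓ hℓ s hs
  have hn1 : (1 : ℝ) ≤ n := by exact_mod_cast (by omega : 1 ≤ n)
  have hn0 : (0 : ℝ) < n := by linarith
  have ht0 : (0 : ℝ) < t n := (Real.rpow_pos_of_pos hn0 _).trans_le (ht_ge n)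
  have htn : t n ≤ n := by
    refine Nat.ceil_le.2 ?_
    calc (n : ℝ) ^ (1 - η) ≤ (n : ℝ) ^ (1 : ℝ) :=
          Real.rpow_le_rpow_of_exponent_le hn1 (by linarith)
      _ = n := Real.rpow_one _
  have ht_le : (t n : ℝ) ≤ 2 * (n : ℝ) ^ (1 - η) := by
    have h1 := Nat.ceil_lt_add_one (Real.rpow_nonneg hn0.le (1 - η))
    have h2 := Real.one_le_rpow hn1 (by linarith : 0 ≤ 1 - η)
    have h3 : (t n : ℝ) < (n : ℝ) ^ (1 - η) + 1 := h1
    linarith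
  have ht_neg : ∀ x : ℝ, 0 ≤ x → (t n : ℝ) ^ (-x) ≤ (n : ℝ) ^ (-((1 - η) * x)) := by
    intro x hx
    rw [← mul_neg, Real.rpow_mul hn0.le]
    exact Real.rpow_le_rpow_of_nonpos (by positivity) (ht_ge n) (by linarith)
  have hqn := ht_neg γ hγ0
  set q : ℝ := (t n : ℝ) ^ (-γ) with hq
  have hq0 : 0 < q := Real.rpow_pos_of_pos ht0 _
  -- The Chernoff exponent is at most `log 2 * V - t ^ (1 - γ) / 2`; the divisor `4` leaves `-t ^ (1
  -- - γ) / 4`.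
  set V : ℝ := (t n : ℝ) ^ (1 - γ) / 4 with hV
  have hV0 : 0 < V := by positivity
  set D : ℝ := C₁ * (n : ℝ) ^ e with hDdef
  have hD0 : 0 ≤ D := by positivity
  have hne1 : 1 ≤ (n : ℝ) ^ e := Real.one_le_rpow hn1 he0.le
  have hqD' : 6 * q * (D + 1) ≤ 1 / 2 := by
    refine le_trans ?_ hqD
    calc 6 * q * (D + 1) ≤ 6 * (n : ℝ) ^ (-((1 - η) * γ)) * ((C₁ + 1) * (n : ℝ) ^ e) := by
          gcongr
          rw [hDdef]
          linarith
      _ = 6 * (C₁ + 1) * ((n : ℝ) ^ (-((1 - η) * γ)) * (n : ℝ) ^ e) := by ring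
      _ = 6 * (C₁ + 1) * (n : ℝ) ^ (-(γ * (1 - η) - e)) := by
          rw [← Real.rpow_add hn0]
          congr 2
          ring
  have hq_le : ∀ i : ℕ, t n < i → (i : ℝ) ^ (-γ) ≤ q := fun i hi =>
    Real.rpow_le_rpow_of_nonpos ht0 (by exact_mod_cast hi.le) (by linarith)
  have key := evolve_indicator_diam_le (ℓ := ℓ) hℓ hp htn hq_le (by linarith) hD0 hqD' hV0
    (C * (n : ℝ) ^ ((1 - η) * e)) (C₁ * (t n : ℝ) ^ e) s
  refine key.trans ?_
  have hM1 : (n : ℝ) ^ (-(2 * (M + 1))) ≤ (n : ℝ) ^ (-(M + 1)) :=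
    Real.rpow_le_rpow_of_exponent_le hn1 (by linarith)
  have hT1 := (hD ℓ hℓ s hs).trans hM1
  have hT2 : evolve ℓ (fun i => (i : ℝ) ^ (-γ)) 0 (t n)
      ({s : TreeWalker | C₁ * (t n : ℝ) ^ e ≤ s.graph.diam}.indicator 1) s
        ≤ (n : ℝ) ^ (-(M + 1)) := by
    refine (hB ℓ hℓ s hs).trans ((ht_neg _ (by linarith)).trans ?_)
    exact Real.rpow_le_rpow_of_exponent_le hn1 (by nlinarith)
  have hT3 : evolve ℓ (fun i => (i : ℝ) ^ (-γ)) 0 (t n)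
      ({s : TreeWalker | (s.order : ℝ) ≤ V}.indicator 1) s ≤ (n : ℝ) ^ (-(M + 1)) := by
    refine (evolve_indicator_order_le hp V (t n) s).trans (le_trans ?_ hexp)
    rw [Real.rpow_def_of_pos two_pos, ← Real.exp_add, Real.exp_le_exp]
    have h1 := rpow_le_sum_rpow_neg hγ0 hγ' (t n)
    have h2 : (n : ℝ) ^ ((1 - η) * (1 - γ)) ≤ (t n : ℝ) ^ (1 - γ) := by
      rw [Real.rpow_mul hn0.le]
      exact Real.rpow_le_rpow (by positivity) (ht_ge n) (by linarith)
    have h3 : Real.log 2 * V ≤ 1 * V := by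
      gcongr
      linarith [Real.log_two_lt_d9]
    linarith
  have hT4 : 8 * ((2 : ℝ) ^ (-(C * (n : ℝ) ^ ((1 - η) * e) / 2)) * 2 ^ (C₁ * (t n : ℝ) ^ e)
      * Real.exp (n * (12 * q / V + 60 * q ^ 2 * (D + 2)))) * (s.order + n)
        ≤ (n : ℝ) ^ (-(M + 1)) := by
    have hexpo := exp_window_le (γ := γ) (C := C₁) hn1 (ht_ge n) ht_le hγ0 hγ'.le he0.le he
      hC₁.le hη.le hηγ hηe
    rw [← hC] at hexpo
    set N : ℝ := (n : ℝ) ^ ((1 - η) * e) with hN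
    have hpoly : 8 * ((s.order : ℝ) + n) ≤ (n : ℝ) ^ (2 : ℝ) := by
      have h1 : 8 * ((m : ℝ) + 1) ≤ n := by exact_mod_cast hnm
      have h2 : (0 : ℝ) ≤ m := m.cast_nonneg
      rw [hs, Real.rpow_two]
      nlinarith
    calc _ = (2 : ℝ) ^ (-(C * N / 2)) * 2 ^ (C₁ * (t n : ℝ) ^ e)
          * Real.exp (n * (12 * q / V + 60 * q ^ 2 * (D + 2))) * (8 * ((s.order : ℝ) + n)) := by
          ring
      _ ≤ (n : ℝ) ^ (-(M + 3)) * (n : ℝ) ^ (2 : ℝ) := by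
          refine mul_le_mul (hexpo.trans hexp') hpoly (by positivity) (by positivity)
      _ = (n : ℝ) ^ (-(M + 1)) := by
          rw [← Real.rpow_add hn0]
          congr 1
          ring
  have hfin : 4 * (n : ℝ) ^ (-(M + 1)) ≤ (n : ℝ) ^ (-M) := by
    have h1 : (n : ℝ) ^ (-M) = n * (n : ℝ) ^ (-(M + 1)) := by
      rw [mul_comm, ← Real.rpow_add_one hn0.ne']
      congr 1
      ring
    rw [h1]
    gcongr
    exact_mod_cast hn4
  linarith

theorem hasDiamTail {γ : ℝ} (hγ : 1 / 2 < γ) (hγ' : γ < 1) (m : ℕ) {ε : ℝ} (hε : 0 < ε) :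
    HasDiamTail γ m ε := by
  have hγ0 : 0 ≤ γ := by linarith
  set δ := min ε (1 / 2) with hδ
  have hδ0 : 0 < δ := lt_min hε one_half_pos
  have hδ2 : δ ≤ 1 / 2 := min_le_right _ _
  -- One `η` serves every improvement: as long as `e ≥ δ`, the bound `η ≤ δ / 2` yields `η ≤ (1 - η)
  -- * e`.
  set η := min (δ / 2) ((2 * γ - 1) / 3) with hη
  have hη0 : 0 < η := lt_min (by linarith) (by linarith)
  have hηδ : η ≤ δ / 2 := min_le_left _ _
  have hηγ : η ≤ (2 * γ - 1) / 3 := min_le_right _ _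
  have hall : ∀ j : ℕ, HasDiamTail γ m (max ((1 - η) ^ j * (1 / 2)) δ) := by
    intro j
    induction j with
    | zero => exact (hasDiamTail_half hγ hγ' m).mono hγ0 (by simp)
    | succ j ih =>
      rcases le_total ((1 - η) ^ j * (1 / 2)) δ with hj | hj
      · rw [max_eq_right hj] at ih
        exact ih.mono hγ0 (le_max_right _ _)
      · rw [max_eq_left hj] at ih
        refine (ih.improve hγ hγ' ?_ hη0 (by linarith) (by nlinarith)).mono hγ0
          ((Eq.le (by ring)).trans (le_max_left _ _))
        have := pow_le_one₀ (n := j) (by linarith : 0 ≤ 1 - η) (by linarith)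
        linarith
  obtain ⟨j, hj⟩ := exists_pow_lt_of_lt_one hδ0 (by linarith : 1 - η < 1)
  have hj0 : 0 ≤ (1 - η) ^ j := pow_nonneg (by linarith) j
  exact (hall j).mono hγ0 (max_le ((by linarith : (1 - η) ^ j * (1 / 2) ≤ δ).trans
    (min_le_left _ _)) (min_le_left _ _))

end TreeWalker

theorem theorem4p1 (γ : ℝ) (hγ : 1 / 2 < γ) (hγ' : γ < 1) (ε : ℝ) (hε : 0 < ε)
    (M : ℝ) (hM : 0 < M) (m : ℕ) :
    ∃ C C' : ℝ, 0 < C ∧ 0 < C' ∧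
      ∀ ℓ : ℕ+, ℓ = 1 ∨ ℓ = 2 →
      ∀ s₀ : TreeWalker, s₀.order = m →
      ∀ n : ℕ, 1 ≤ n →
        (tbrwLaw ℓ (berLaws γ (one_half_pos.trans hγ).le) s₀).real
            {ω | C * (n : ℝ) ^ ε ≤ ((ω n).graph.diam : ℝ)}
          ≤ C' / (n : ℝ) ^ M := by
  obtain ⟨C, hC, hev⟩ := TreeWalker.hasDiamTail hγ hγ' m hε M hM
  obtain ⟨N, hN⟩ := Filter.eventually_atTop.1 hev
  -- For `n ≤ N` this constant makes the right-hand side at least `1`.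
  refine ⟨C, ((N : ℝ) + 1) ^ M, hC, by positivity, fun ℓ hℓ s₀ hs n hn => ?_⟩
  have hn0 : (0 : ℝ) < n := by exact_mod_cast hn
  have hℓ2 : (ℓ : ℕ) ≤ 2 := by rcases hℓ with rfl | rfl <;> decide
  rcases le_total N n with hNn | hNn
  · have h1 := TreeWalker.tbrwLaw_berLaws_real_setOf (one_half_pos.trans hγ).le ℓ s₀ n
      {s : TreeWalker | C * (n : ℝ) ^ ε ≤ s.graph.diam}
    refine h1.le.trans (max_le ((hN n hNn ℓ hℓ2 s₀ hs).trans ?_) (by positivity))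
    rw [Real.rpow_neg hn0.le, ← one_div]
    gcongr
    exact Real.one_le_rpow (by linarith [N.cast_nonneg (α := ℝ)]) hM.le
  · refine measureReal_le_one.trans ?_
    rw [one_le_div (by positivity)]
    refine Real.rpow_le_rpow hn0.le ?_ hM.le
    have : (n : ℝ) ≤ N := by exact_mod_cast hNn
    linarith
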